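/- Let $\mathbb{C}(q)$ be the field of rational functions, $[n]=\frac{q^n-q^{-n}}{q-q^{-1}}$ for $n\in\mathbb{Z}$, and $[a,b]_p=ab-p\,ba$. Let $U_q'$ be the $\mathbb{C}(q)$-algebra (the quantum symmetric pair coideal subalgebra for $(\mathfrak{gl}_4,\mathfrak{gl}_2\times\mathfrak{gl}_2)$) generated by $B_0,B_1,B_{-1},\hat D_\diamondsuit^{\pm1},\hat D_1^{\pm1}$ subject to: $\hat D_j\hat D_j^{-1}=\hat D_j^{-1}\hat D_j=1$ for $j\in\{\diamondsuit,1\}$; $\hat D_\diamondsuit,\hat D_1$ commute with each other and with $B_0$; $$\hat D_\diamondsuit B_{\pm1}=q^{\pm1}B_{\pm1}\hat D_\diamondsuit,\qquad \hat D_1B_{\pm1}=q^{\mp1}B_{\pm1}\hat D_1,\qquad B_1B_{-1}-B_{-1}B_1=\frac{\hat D_\diamondsuit\hat D_1^{-1}-\hat D_1\hat D_\diamondsuit^{-1}}{q-q^{-1}},$$ $$B_0^2B_{\pm1}-[2]B_0B_{\pm1}B_0+B_{\pm1}B_0^2=B_{\pm1},\qquad B_{\pm1}^2B_0-[2]B_{\pm1}B_0B_{\pm1}+B_0B_{\pm1}^2=0.$$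 Put $X=[B_0,B_1]_{q^{-1}}$, $Y=[B_0,B_{-1}]_{q^{-1}}$, $Z=[B_1,Y]_{q^{-1}}$. A weight space of a $U_q'$-module is a simultaneous eigenspace of $\hat D_\diamondsuit,\hat D_1,B_0,Z$; a maximal vector is a nonzero vector in a weight space that is killed by $B_1$ and $X$. For $\kappa_\diamondsuit,\kappa_1\in\mathbb{Z}$ and $\beta,\zeta\in\mathbb{C}(q)$ the Verma module $\mathbb{M}(\kappa_\diamondsuit,\kappa_1,\beta,\zeta)$ is the $U_q'$-module generated by a universal vector killed by $B_1$ and $X$ on which $\hat D_\diamondsuit,\hat D_1,B_0,Z$ act by $q^{\kappa_\diamondsuit},q^{\kappa_1},\beta,\zeta$, and $\mathsf{L}(\kappa_\diamondsuit,\kappa_1,\beta,\zeta)$ is its unique irreducible quotient (the quotient by the sum of all proper submodules). Write $\kappa=\kappa_\diamondsuit-\kappa_1$. A $U_q'$-module is called rational if it is finite dimensional over $\mathbb{C}(q)$, $B_0$ acts diagonalizably with eigenvalues in $\{[n]\mid n\in\mathbb{Z}\}$, and $\hat D_\diamondsuit,\hat D_1$ act diagonalizably with eigenvalues in $q^{\mathbb{Z}}$.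 Theorem. (1) Every irreducible rational $U_q'$-module is isomorphic to $\mathsf{L}(\kappa_\diamondsuit,\kappa_1,[n],[n+\kappa-2i]-q^{-\kappa}[n])$ for some $\kappa_\diamondsuit,\kappa_1,n,i\in\mathbb{Z}$ with $0\le i\le\kappa$ (so $\kappa_\diamondsuit\ge\kappa_1$), and conversely each of these modules is irreducible and rational. (2) Let $\mathbf{P}_{1/2}=\{(\lambda_1,\lambda_2)\mid \lambda_1-\lambda_2\in\mathbb{Z}_{\ge0},\ 2\lambda_1,2\lambda_2\in\mathbb{Z}\}$. Taking the highest weight, that is, $$\mathsf{L}(\kappa_\diamondsuit,\kappa_1,[n],[n+\kappa-2i]-q^{-\kappa}[n])\longmapsto\Big(\big(\tfrac{\kappa_\diamondsuit+n}{2},\tfrac{\kappa_\diamondsuit+n}{2}-i\big),\big(\tfrac{\kappa_\diamondsuit-n}{2},\tfrac{\kappa_\diamondsuit-n}{2}-\kappa+i\big)\Big)\qquad(0\le i\le\kappa),$$ is a well-defined bijection from the set of isomorphism classes of irreducible rational $U_q'$-modules onto $$\{(\lambda,\mu)\in\mathbf{P}_{1/2}\times\mathbf{P}_{1/2}\mid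 \lambda_1-\mu_1\in\mathbb{Z}\}.$$ The value at the class of $V$ is given by the same formula whenever $V$ has a maximal vector of weight $(q^{\kappa_\diamondsuit},q^{\kappa_1},[n],[n+\kappa-2i]-q^{-\kappa}[n])$ with $0\le i\le\kappa$. (3) Every irreducible rational $U_q'$-module is, over $\mathbb{C}(q)$, the direct sum of its weight spaces, and each nonzero weight space is one-dimensional. -/

import Mathlib

namespace QSP

noncomputable section

/-- The ground field: rational functions in one variable over the complex numbers. -/
abbrev Cq : Type := RatFunc ℂ

/-- The variable of the ground field. -/
def q : Cq := RatFunc.X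

/-- The quantum integer `[n]`. -/
def qInt (n : ℤ) : Cq := (q ^ n - q ^ (-n)) / (q - q⁻¹)

/-- The generators; `Dd` is the generator indexed by the diamond, and `DdInv`, `D1Inv` are
the inverses of `Dd`, `D1`. -/
inductive Gen : Type
  | B0 | B1 | Bm1 | Dd | DdInv | D1 | D1Inv

/-- The free algebra on the generators. -/
abbrev Free : Type := FreeAlgebra Cq Gen

/-- A generator inside the free algebra. -/
def gen (g : Gen) : Free := FreeAlgebra.ι Cq g

/-- The defining relations of the coideal subalgebra. -/
inductive Rel : Free → Free → Prop
  | Dd_mul_inv : Rel (gen .Dd * gen .DdInv) 1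
  | Dd_inv_mul : Rel (gen .DdInv * gen .Dd) 1
  | D1_mul_inv : Rel (gen .D1 * gen .D1Inv) 1
  | D1_inv_mul : Rel (gen .D1Inv * gen .D1) 1
  | Dd_D1 : Rel (gen .Dd * gen .D1) (gen .D1 * gen .Dd)
  | Dd_B1 : Rel (gen .Dd * gen .B1) (q • (gen .B1 * gen .Dd))
  | Dd_Bm1 : Rel (gen .Dd * gen .Bm1) (q⁻¹ • (gen .Bm1 * gen .Dd))
  | D1_B1 : Rel (gen .D1 * gen .B1) (q⁻¹ • (gen .B1 * gen .D1))
  | D1_Bm1 : Rel (gen .D1 * gen .Bm1) (q • (gen .Bm1 * gen .D1))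
  | B0_Dd : Rel (gen .B0 * gen .Dd) (gen .Dd * gen .B0)
  | B0_D1 : Rel (gen .B0 * gen .D1) (gen .D1 * gen .B0)
  | B1_Bm1 : Rel (gen .B1 * gen .Bm1 - gen .Bm1 * gen .B1)
      ((q - q⁻¹)⁻¹ • (gen .Dd * gen .D1Inv - gen .D1 * gen .DdInv))
  | serre_B0_B1 : Rel
      (gen .B0 ^ 2 * gen .B1 - qInt 2 • (gen .B0 * gen .B1 * gen .B0) + gen .B1 * gen .B0 ^ 2)
      (gen .B1)
  | serre_B0_Bm1 : Rel
      (gen .B0 ^ 2 * gen .Bm1 - qInt 2 • (gen .B0 * gen .Bm1 * gen .B0) + gen .Bm1 * gen .B0 ^ 2)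
      (gen .Bm1)
  | serre_B1_B0 : Rel
      (gen .B1 ^ 2 * gen .B0 - qInt 2 • (gen .B1 * gen .B0 * gen .B1) + gen .B0 * gen .B1 ^ 2)
      0
  | serre_Bm1_B0 : Rel
      (gen .Bm1 ^ 2 * gen .B0 - qInt 2 • (gen .Bm1 * gen .B0 * gen .Bm1) + gen .B0 * gen .Bm1 ^ 2)
      0

/-- The quantum symmetric pair coideal subalgebra attached to `(gl₄, gl₂ × gl₂)`,
by generators and relations. -/
abbrev U : Type := RingQuot Rel

/-- The class of a generator in the algebra. -/
def cls (g : Gen) : U := RingQuot.mkAlgHom Cq Rel (gen g)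

def B0 : U := cls .B0
def B1 : U := cls .B1
def Bm1 : U := cls .Bm1
def Dd : U := cls .Dd
def D1 : U := cls .D1

/-- The twisted commutator `[a, b]_p = a b - p b a`. -/
def qComm (p : Cq) (a b : U) : U := a * b - p • (b * a)

def X : U := qComm q⁻¹ B0 B1
def Y : U := qComm q⁻¹ B0 Bm1
def Z : U := qComm q⁻¹ B1 Y

section Modules

variable (V : Type*) [AddCommGroup V] [Module Cq V] [Module U V] [IsScalarTower Cq U V]

/-- The operator on a module given by an element of the algebra. -/
def act (u : U) : Module.End Cq V := Algebra.lsmul Cq Cq V u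

/-- The action of `u` is diagonalizable with all its eigenvalues in `S`: the space is the sum
of the eigenspaces of `u` with eigenvalue in `S`. -/
def DiagonalizableIn (u : U) (S : Set Cq) : Prop :=
  ⨆ c ∈ S, (act V u).eigenspace c = ⊤

/-- Rational representations. -/
structure IsRational : Prop where
  finite : Module.Finite Cq V
  diag_B0 : DiagonalizableIn V B0 (Set.range qInt)
  diag_Dd : DiagonalizableIn V Dd (Set.range fun n : ℤ => q ^ n)
  diag_D1 : DiagonalizableIn V D1 (Set.range fun n : ℤ => q ^ n)

/-- The weight space: the simultaneous eigenspace of `Dd`, `D1`, `B0`, `Z` with the eigenvalues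
`w.1`, `w.2.1`, `w.2.2.1`, `w.2.2.2`. -/
def weightSpace (w : Cq × Cq × Cq × Cq) : Submodule Cq V :=
  (act V Dd).eigenspace w.1 ⊓ (act V D1).eigenspace w.2.1 ⊓
    (act V B0).eigenspace w.2.2.1 ⊓ (act V Z).eigenspace w.2.2.2

/-- The module is the direct sum of its weight spaces, and each nonzero weight space is
one-dimensional. -/
structure IsSumOfWeightLines : Prop where
  independent : iSupIndep (weightSpace V)
  iSup_eq_top : ⨆ w, weightSpace V w = ⊤
  finrank_eq_one : ∀ w, weightSpace V w ≠ ⊥ → Module.finrank Cq (weightSpace V w) = 1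

/-- A (nonzero) maximal vector of weight `(q ^ κd, q ^ κ1, β, ζ)`. -/
structure IsMaximalVector (κd κ1 : ℤ) (β ζ : Cq) (v : V) : Prop where
  ne_zero : v ≠ 0
  mem_weightSpace : v ∈ weightSpace V (q ^ κd, q ^ κ1, β, ζ)
  B1_smul : B1 • v = 0
  X_smul : X • v = 0

end Modules

/-- The left ideal annihilating the highest weight vector of the Verma module: it is generated by
the elements by which the positive and the Cartan part differ from their action on the
one-dimensional module of highest weight `(κd, κ1, β, ζ)`. -/
def vermaIdeal (κd κ1 : ℤ) (β ζ : Cq) : Submodule U U :=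
  Submodule.span U
    {B1, X, Dd - algebraMap Cq U (q ^ κd), D1 - algebraMap Cq U (q ^ κ1),
      B0 - algebraMap Cq U β, Z - algebraMap Cq U ζ}

/-- The Verma module of highest weight `(κd, κ1, β, ζ)`. -/
abbrev Verma (κd κ1 : ℤ) (β ζ : Cq) : Type := U ⧸ vermaIdeal κd κ1 β ζ

/-- The sum of all proper submodules of the Verma module. -/
def vermaRadical (κd κ1 : ℤ) (β ζ : Cq) : Submodule U (Verma κd κ1 β ζ) :=
  sSup {N | N ≠ ⊤}

/-- The irreducible quotient of the Verma module. -/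
abbrev L (κd κ1 : ℤ) (β ζ : Cq) : Type := Verma κd κ1 β ζ ⧸ vermaRadical κd κ1 β ζ

/-- The dominant value `[n + κ - 2 i] - q ^ (-κ) [n]` with `κ = κd - κ1`. -/
def domZeta (κd κ1 n i : ℤ) : Cq :=
  qInt (n + (κd - κ1) - 2 * i) - q ^ (-(κd - κ1)) * qInt n

/-- An irreducible rational representation. -/
structure RatIrrep where
  carrier : Type
  [addCommGroup : AddCommGroup carrier]
  [moduleCq : Module Cq carrier]
  [moduleU : Module U carrier]
  [isScalarTower : IsScalarTower Cq U carrier]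
  rational : IsRational carrier
  irreducible : IsSimpleModule U carrier

attribute [instance] RatIrrep.addCommGroup RatIrrep.moduleCq RatIrrep.moduleU
  RatIrrep.isScalarTower

/-- Isomorphism of irreducible rational representations. -/
instance RatIrrep.isoSetoid : Setoid RatIrrep where
  r V W := Nonempty (V.carrier ≃ₗ[U] W.carrier)
  iseqv :=
    { refl := fun _ => ⟨LinearEquiv.refl _ _⟩
      symm := fun ⟨e⟩ => ⟨e.symm⟩
      trans := fun ⟨e⟩ ⟨f⟩ => ⟨e.trans f⟩ }

/-- Isomorphism classes of irreducible rational representations. -/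
abbrev RatIrrepClass : Type 1 := Quotient RatIrrep.isoSetoid

/-- Pairs of half-integers with difference a nonnegative integer. -/
def PHalf : Set (ℚ × ℚ) :=
  {l | (∃ k : ℕ, l.1 - l.2 = k) ∧ (∃ a : ℤ, 2 * l.1 = a) ∧ ∃ b : ℤ, 2 * l.2 = b}

/-- Pairs of elements of `PHalf` whose entries are congruent modulo the integers. -/
def PHalfPairs : Set ((ℚ × ℚ) × (ℚ × ℚ)) :=
  {p | p.1 ∈ PHalf ∧ p.2 ∈ PHalf ∧ ∃ m : ℤ, p.1.1 - p.2.1 = m}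

/-- The pair attached to the highest weight `(κd, κ1, [n], [n + κ - 2 i] - q ^ (-κ) [n])`. -/
def label (κd κ1 n i : ℤ) : (ℚ × ℚ) × (ℚ × ℚ) :=
  ((((κd : ℚ) + n) / 2, ((κd : ℚ) + n) / 2 - i),
    (((κd : ℚ) - n) / 2, ((κd : ℚ) - n) / 2 - ((κd : ℚ) - κ1) + i))

end

end QSP

/-! The argument is highest weight theory, with one twist: `Bm1` does not map eigenvectors of `B0`
to eigenvectors. If `B0` acts on `w` by `[k]`, the relations make the span of `Y • w` and `Bm1 • w`
stable under `B0`, with eigenvalues `[k + 1]` and `[k - 1]`; the eigenvectors are `G 1 k • w` and `G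
(-1) k • w`. Lowering thus splits into two kinds of ladder steps, which commute (`G_comm`) and along
which `Z` acts diagonally (`Z_G`).

A module generated by a maximal vector is therefore spanned by a grid of vectors, `a` steps of one
kind and `b` of the other. The weight determines `a + b` and `a - b`, so weight spaces are lines.
The top weight space is also a line, hence the sum of the proper submodules is proper, and a simple
module is determined by the weight of a maximal vector.

Dominance comes from `IsWt.B1_Gs`, the analogue of the sl₂ formula for raising a lowered vector. In
finite dimension both ladders stop. Stopping of the plus ladder produces an eigenvector `v` of `Z`
with eigenvalue `-(q ^ (-κ) [n] + [κ - n - 2 m])`; the minus ladder from `v`, with last nonzero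
vector after `j` steps, forces the eigenvalue `[n + κ - 2 j] - q ^ (-κ) [n]`. Injectivity of `qInt`
gives `κ = m + j`, which is the condition `0 ≤ i ≤ κ` for `i = j`.

Conversely, for `r = κ - i` and `s = i` an explicit action on a space with basis `ℤ × ℤ` has a
maximal vector of the required weight at the origin. The rectangle `[0, r] × [0, s]` spans a finite
dimensional submodule containing it, so the irreducible quotient of the Verma module is finite
dimensional. The labels are then an affine change of the parameters. -/

namespace QSP

set_option linter.unusedSectionVars false

noncomputable section

/-! ### Scalars -/

/-- The canonical algebra structure over the naturals, preferred to the one through polynomials. -/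
instance : Algebra ℕ Cq := Semiring.toNatAlgebra

/-- The canonical algebra structure over the integers, preferred to the one through polynomials. -/
instance : Algebra ℤ Cq := Ring.toIntAlgebra Cq

theorem q_ne_zero : q ≠ 0 := RatFunc.X_ne_zero

theorem q_pow_ne_one {n : ℕ} (hn : n ≠ 0) : q ^ n ≠ 1 := by
  intro h
  have h1 : algebraMap (Polynomial ℂ) (RatFunc ℂ) (Polynomial.X ^ n) =
      algebraMap (Polynomial ℂ) (RatFunc ℂ) 1 := by
    rw [map_pow, RatFunc.algebraMap_X, map_one]
    exact h
  have h2 := congrArg Polynomial.natDegree (RatFunc.algebraMap_injective ℂ h1)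
  rw [Polynomial.natDegree_X_pow, Polynomial.natDegree_one] at h2
  exact hn h2

theorem q_zpow_eq_one {n : ℤ} (h : q ^ n = 1) : n = 0 := by
  by_contra hn
  obtain ⟨m, rfl | rfl⟩ := n.eq_nat_or_neg
  · exact q_pow_ne_one (by simpa using hn) (by simpa using h)
  · exact q_pow_ne_one (n := m) (by simpa using hn) (by simpa using h)

theorem q_zpow_injective : Function.Injective fun n : ℤ => q ^ n := by
  intro m n h
  have : q ^ (m - n) = 1 := by
    rw [zpow_sub₀ q_ne_zero, show q ^ m = q ^ n from h, div_self (zpow_ne_zero _ q_ne_zero)]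
  have := q_zpow_eq_one this
  omega

theorem q_zpow_ne_neg_one (n : ℤ) : q ^ n ≠ -1 := by
  intro h
  have h2 : q ^ (n + n) = 1 := by rw [zpow_add₀ q_ne_zero, h]; ring
  have h3 : n = 0 := by have := q_zpow_eq_one h2; omega
  rw [h3, zpow_zero] at h
  have : (2 : Cq) = 0 := by linear_combination h
  exact two_ne_zero this

theorem q_sub_inv_ne_zero : q - q⁻¹ ≠ 0 := by
  intro h
  have h1 : q ^ (1 : ℤ) = q ^ (-1 : ℤ) := by simpa using sub_eq_zero.mp h
  have := q_zpow_injective h1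
  omega

theorem q_sq_sub_one_ne_zero : q ^ 2 - 1 ≠ 0 := sub_ne_zero.mpr (q_pow_ne_one two_ne_zero)

/-- The sum `q ^ n + q ^ (-n)`. -/
def qCosh (n : ℤ) : Cq := q ^ n + q ^ (-n)

theorem qCosh_ne_zero (n : ℤ) : qCosh n ≠ 0 := by
  intro h
  apply q_zpow_ne_neg_one (n + n)
  have h1 : q ^ n * q ^ (-n) = 1 := by rw [← zpow_add₀ q_ne_zero]; simp
  rw [zpow_add₀ q_ne_zero]
  unfold qCosh at h
  linear_combination q ^ n * h - h1

theorem qInt_injective : Function.Injective qInt := by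
  intro m n h
  have hm : q ^ m * q ^ (-m) = 1 := by rw [← zpow_add₀ q_ne_zero]; simp
  have hn : q ^ n * q ^ (-n) = 1 := by rw [← zpow_add₀ q_ne_zero]; simp
  have h1 : q ^ m - q ^ (-m) = q ^ n - q ^ (-n) := by
    simpa only [qInt, div_left_inj' q_sub_inv_ne_zero] using h
  -- Up to a nonzero factor this is `[m] - [n]`; the second factor cannot vanish because no power of
  -- `q` equals `-1`.
  have h2 : (q ^ m - q ^ n) * (q ^ (m + n) + 1) = 0 := by
    rw [zpow_add₀ q_ne_zero]
    linear_combination q ^ m * q ^ n * h1 + q ^ n * hm - q ^ m * hn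
  rcases mul_eq_zero.mp h2 with h3 | h3
  · exact q_zpow_injective (sub_eq_zero.mp h3)
  · exact absurd (eq_neg_of_add_eq_zero_left h3) (q_zpow_ne_neg_one _)

theorem qInt_zero : qInt 0 = 0 := by simp [qInt]

theorem qInt_one : qInt 1 = 1 := by
  have := q_sub_inv_ne_zero
  simp only [qInt, zpow_one, zpow_neg]
  exact div_self this

theorem qInt_neg (n : ℤ) : qInt (-n) = -qInt n := by
  simp only [qInt, neg_neg]
  ring

theorem qInt_ne_zero {n : ℤ} (hn : n ≠ 0) : qInt n ≠ 0 := fun h =>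
  hn (qInt_injective (h.trans qInt_zero.symm))

theorem qInt_two : qInt 2 = q + q⁻¹ := by
  have h0 := q_ne_zero
  have h1 := q_sub_inv_ne_zero
  have h2 : (q ^ (2 : ℤ)) = q ^ 2 := by norm_cast
  simp only [qInt, zpow_neg, h2]
  rw [div_eq_iff h1]
  field_simp
  ring

/-! ### Relations in the algebra -/

/-- The inverse of `Dd`. -/
def DdInv : U := cls .DdInv
/-- The inverse of `D1`. -/
def D1Inv : U := cls .D1Inv

/-- The commutator of `B1` and `Bm1`. -/
def H : U := (q - q⁻¹)⁻¹ • (Dd * D1Inv - D1 * DdInv)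

theorem mk_rel {a b : Free} (h : Rel a b) :
    RingQuot.mkAlgHom Cq Rel a = RingQuot.mkAlgHom Cq Rel b :=
  RingQuot.mkAlgHom_rel Cq h

theorem Dd_mul_DdInv : Dd * DdInv = 1 := by
  simpa [Dd, DdInv, cls] using mk_rel .Dd_mul_inv

theorem DdInv_mul_Dd : DdInv * Dd = 1 := by
  simpa [Dd, DdInv, cls] using mk_rel .Dd_inv_mul

theorem D1_mul_D1Inv : D1 * D1Inv = 1 := by
  simpa [D1, D1Inv, cls] using mk_rel .D1_mul_inv

theorem D1Inv_mul_D1 : D1Inv * D1 = 1 := by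
  simpa [D1, D1Inv, cls] using mk_rel .D1_inv_mul

theorem Dd_mul_D1 : Dd * D1 = D1 * Dd := by
  simpa [D1, Dd, cls] using mk_rel .Dd_D1

theorem Dd_mul_B1 : Dd * B1 = q • (B1 * Dd) := by
  simpa [B1, Dd, cls] using mk_rel .Dd_B1

theorem Dd_mul_Bm1 : Dd * Bm1 = q⁻¹ • (Bm1 * Dd) := by
  simpa [Bm1, Dd, cls] using mk_rel .Dd_Bm1

theorem D1_mul_B1 : D1 * B1 = q⁻¹ • (B1 * D1) := by
  simpa [B1, D1, cls] using mk_rel .D1_B1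

theorem D1_mul_Bm1 : D1 * Bm1 = q • (Bm1 * D1) := by
  simpa [Bm1, D1, cls] using mk_rel .D1_Bm1

theorem Dd_mul_B0 : Dd * B0 = B0 * Dd := by
  simpa [B0, Dd, cls] using (mk_rel .B0_Dd).symm

theorem D1_mul_B0 : D1 * B0 = B0 * D1 := by
  simpa [B0, D1, cls] using (mk_rel .B0_D1).symm

theorem B1_mul_Bm1 : B1 * Bm1 = Bm1 * B1 + H := by
  have h : B1 * Bm1 - Bm1 * B1 = H := by
    simpa only [B1, Bm1, H, D1, D1Inv, Dd, DdInv, cls, map_mul, map_sub, map_smul] using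
      mk_rel .B1_Bm1
  rw [← h]
  abel

theorem serre_B0_B1 : B0 ^ 2 * B1 - qInt 2 • (B0 * B1 * B0) + B1 * B0 ^ 2 = B1 := by
  simpa only [B1, B0, cls, map_mul, map_sub, map_add, map_smul, map_pow] using
    mk_rel .serre_B0_B1

theorem serre_B0_Bm1 : B0 ^ 2 * Bm1 - qInt 2 • (B0 * Bm1 * B0) + Bm1 * B0 ^ 2 = Bm1 := by
  simpa only [Bm1, B0, cls, map_mul, map_sub, map_add, map_smul, map_pow] using
    mk_rel .serre_B0_Bm1

theorem serre_Bm1_B0 : Bm1 ^ 2 * B0 - qInt 2 • (Bm1 * B0 * Bm1) + B0 * Bm1 ^ 2 = 0 := by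
  simpa only [Bm1, B0, cls, map_mul, map_sub, map_add, map_smul, map_pow, map_zero] using
    mk_rel .serre_Bm1_B0

theorem Y_mul_Bm1 : Y * Bm1 = q • (Bm1 * Y) := by
  have h := serre_Bm1_B0
  have h0 := q_ne_zero
  rw [← sub_eq_zero, ← h, qInt_two]
  simp only [Y, qComm, mul_sub, sub_mul, smul_mul_assoc, mul_smul_comm, smul_sub, smul_smul,
    mul_assoc, pow_two, mul_inv_cancel₀ h0]
  module

theorem B0_mul_Y : B0 * Y = q • (Y * B0) + Bm1 := by
  have h := serre_B0_Bm1
  have h0 := q_ne_zero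
  rw [← h, qInt_two]
  simp only [Y, qComm, mul_sub, sub_mul, smul_mul_assoc, mul_smul_comm, smul_sub, smul_smul,
    mul_assoc, pow_two, mul_inv_cancel₀ h0]
  module

theorem B0_mul_X : B0 * X = q • (X * B0) + B1 := by
  have h := serre_B0_B1
  have h0 := q_ne_zero
  rw [← h, qInt_two]
  simp only [X, qComm, mul_sub, sub_mul, smul_mul_assoc, mul_smul_comm, smul_sub, smul_smul,
    mul_assoc, pow_two, mul_inv_cancel₀ h0]
  module

theorem B0_mul_Bm1 : B0 * Bm1 = Y + q⁻¹ • (Bm1 * B0) := by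
  simp [Y, qComm]

theorem B0_mul_B1 : B0 * B1 = X + q⁻¹ • (B1 * B0) := by
  simp [X, qComm]

theorem B1_mul_Y : B1 * Y = q⁻¹ • (Y * B1) + Z := by
  simp [Z, qComm]

/-- Expanding `Z` in `B1` and `Y`, each of the two summands meets one commutator of `B1` with `Bm1`;
these give the two terms with `H`. -/
theorem Z_mul_Bm1 : Z * Bm1 = q • (Bm1 * Z) + q • (H * Y) - q⁻¹ • (Y * H) := by
  have h0 := q_ne_zero
  have h1 : B1 * (Bm1 * Y) = Bm1 * (q⁻¹ • (Y * B1) + Z) + H * Y := by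
    rw [← mul_assoc, B1_mul_Bm1, add_mul, mul_assoc, B1_mul_Y]
  have h2 : Y * (Bm1 * B1) = q • (Bm1 * (Y * B1)) := by
    rw [← mul_assoc, Y_mul_Bm1, smul_mul_assoc, mul_assoc]
  rw [show Z = B1 * Y - q⁻¹ • (Y * B1) from rfl, sub_mul, mul_assoc, Y_mul_Bm1, smul_mul_assoc,
    mul_assoc, B1_mul_Bm1, mul_smul_comm, h1, mul_add Y, h2]
  rw [show B1 * Y - q⁻¹ • (Y * B1) = Z from rfl]
  simp only [mul_add, smul_add, mul_smul_comm, smul_smul, inv_mul_cancel₀ h0, mul_inv_cancel₀ h0]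
  module

theorem DdInv_comm_of {u : U} {c c' : Cq} (hc : c' * c = 1) (h : Dd * u = c • (u * Dd)) :
    DdInv * u = c' • (u * DdInv) := by
  have h1 : DdInv * (Dd * u) * DdInv = c • (DdInv * u) := by
    rw [h, mul_smul_comm, smul_mul_assoc, ← mul_assoc, mul_assoc _ Dd, Dd_mul_DdInv, mul_one]
  rw [← mul_assoc, DdInv_mul_Dd, one_mul] at h1
  rw [h1, smul_smul, hc, one_smul]

theorem D1Inv_comm_of {u : U} {c c' : Cq} (hc : c' * c = 1) (h : D1 * u = c • (u * D1)) :
    D1Inv * u = c' • (u * D1Inv) := by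
  have h1 : D1Inv * (D1 * u) * D1Inv = c • (D1Inv * u) := by
    rw [h, mul_smul_comm, smul_mul_assoc, ← mul_assoc, mul_assoc _ D1, D1_mul_D1Inv, mul_one]
  rw [← mul_assoc, D1Inv_mul_D1, one_mul] at h1
  rw [h1, smul_smul, hc, one_smul]

theorem H_mul_B0 : H * B0 = B0 * H := by
  have h1 : DdInv * B0 = B0 * DdInv := by
    simpa using DdInv_comm_of (c := 1) (c' := 1) (by simp) (by simpa using Dd_mul_B0)
  have h2 : D1Inv * B0 = B0 * D1Inv := by
    simpa using D1Inv_comm_of (c := 1) (c' := 1) (by simp) (by simpa using D1_mul_B0)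
  simp only [H, smul_mul_assoc, mul_smul_comm, sub_mul, mul_sub, mul_assoc, h1, h2]
  simp only [← mul_assoc, Dd_mul_B0, D1_mul_B0]

theorem X_mul_Bm1 : X * Bm1 =
    q⁻¹ • (Bm1 * X) + (1 - q⁻¹ * q⁻¹) • (Y * B1 + H * B0) - q⁻¹ • Z := by
  have h1 : B0 * (Bm1 * B1) = Y * B1 + q⁻¹ • (Bm1 * X) + (q⁻¹ * q⁻¹) • (Bm1 * (B1 * B0)) := by
    rw [← mul_assoc, B0_mul_Bm1, add_mul, smul_mul_assoc, mul_assoc, B0_mul_B1]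
    simp only [mul_add, mul_smul_comm]
    module
  have h2 : B1 * (B0 * Bm1) = q⁻¹ • (Y * B1) + Z + q⁻¹ • (Bm1 * (B1 * B0) + H * B0) := by
    rw [B0_mul_Bm1, mul_add, B1_mul_Y, mul_smul_comm, ← mul_assoc, B1_mul_Bm1, add_mul, mul_assoc]
  rw [show X = B0 * B1 - q⁻¹ • (B1 * B0) from rfl, sub_mul, smul_mul_assoc, mul_assoc, mul_assoc,
    h2, B1_mul_Bm1, mul_add, h1]
  rw [show B0 * B1 - q⁻¹ • (B1 * B0) = X from rfl, H_mul_B0]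
  module

/-- The commutator of `B0` with `Z` is computed twice: from the definition of `Z`, and by moving
`B0` through the formula for `X * Bm1`. The two results differ in the sign and power of `q` in front
of the commutator, so it is annihilated by `q + q⁻¹`, a nonzero scalar. -/
theorem B0_mul_Z : B0 * Z = Z * B0 := by
  have h0 := q_ne_zero
  have e1 : B0 * Z - Z * B0 = X * Y - Y * X + q⁻¹ • H := by
    have a1 : B0 * (B1 * Y) = X * Y + B1 * (Y * B0) + q⁻¹ • (B1 * Bm1) := by
      rw [← mul_assoc, B0_mul_B1, add_mul, smul_mul_assoc, mul_assoc, B0_mul_Y]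
      simp only [mul_add, mul_smul_comm, smul_add, smul_smul, inv_mul_cancel₀ h0]
      module
    have a2 : B0 * (Y * B1) = q • (Y * X) + Y * (B1 * B0) + Bm1 * B1 := by
      rw [← mul_assoc, B0_mul_Y, add_mul, smul_mul_assoc, mul_assoc, B0_mul_B1]
      simp only [mul_add, mul_smul_comm, smul_add, smul_smul, mul_inv_cancel₀ h0]
      module
    rw [show Z = B1 * Y - q⁻¹ • (Y * B1) from rfl, mul_sub, sub_mul, mul_smul_comm, a1, a2,
      B1_mul_Bm1]
    simp only [smul_mul_assoc, smul_add, smul_smul, inv_mul_cancel₀ h0, mul_assoc]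
    module
  have e2 : B0 * (X * Bm1) - X * Bm1 * B0 = q • (Y * X) + Bm1 * B1 - q⁻¹ • (B0 * Z - Z * B0) := by
    have a1 : B0 * (Bm1 * X) = Y * X + Bm1 * (X * B0) + q⁻¹ • (Bm1 * B1) := by
      rw [← mul_assoc, B0_mul_Bm1, add_mul, smul_mul_assoc, mul_assoc, B0_mul_X]
      simp only [mul_add, mul_smul_comm, smul_add, smul_smul, inv_mul_cancel₀ h0]
      module
    have a2 : B0 * (Y * B1) = q • (Y * X) + Y * (B1 * B0) + Bm1 * B1 := by
      rw [← mul_assoc, B0_mul_Y, add_mul, smul_mul_assoc, mul_assoc, B0_mul_B1]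
      simp only [mul_add, mul_smul_comm, smul_add, smul_smul, mul_inv_cancel₀ h0]
      module
    have a3 : B0 * (H * B0) = H * B0 * B0 := by rw [← mul_assoc, H_mul_B0]
    rw [X_mul_Bm1]
    simp only [mul_add, add_mul, mul_sub, sub_mul, mul_smul_comm, smul_mul_assoc, a1, a2, a3,
      mul_assoc]
    match_scalars <;> field_simp <;> ring
  have e3 : q • (X * Y) = B0 * (X * Bm1) - X * Bm1 * B0 - B1 * Bm1 := by
    have a1 : q • (X * (B0 * Bm1)) = B0 * (X * Bm1) - B1 * Bm1 := by
      rw [← mul_assoc, ← mul_assoc, B0_mul_X, add_mul, smul_mul_assoc]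
      abel
    rw [show Y = B0 * Bm1 - q⁻¹ • (Bm1 * B0) from rfl, mul_sub, smul_sub, a1, mul_smul_comm,
      smul_smul, mul_inv_cancel₀ h0, one_smul, mul_assoc]
    abel
  rw [e2, B1_mul_Bm1] at e3
  have e4 : (q + q⁻¹) • (B0 * Z - Z * B0) = 0 := by
    rw [add_smul]
    nth_rewrite 1 [e1]
    simp only [smul_add, smul_sub, e3, smul_smul, mul_inv_cancel₀ h0]
    module
  have h1 : q + q⁻¹ ≠ 0 := by simpa [qCosh] using qCosh_ne_zero 1
  exact sub_eq_zero.mp ((smul_eq_zero.mp e4).resolve_left h1)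

theorem Dd_mul_Y : Dd * Y = q⁻¹ • (Y * Dd) := by
  simp only [Y, qComm, mul_sub, sub_mul, mul_smul_comm, smul_mul_assoc]
  rw [← mul_assoc, Dd_mul_B0, ← mul_assoc Dd, Dd_mul_Bm1, mul_assoc, Dd_mul_Bm1, smul_mul_assoc,
    mul_assoc Bm1, Dd_mul_B0]
  simp only [mul_smul_comm, mul_assoc, smul_sub]

theorem D1_mul_Y : D1 * Y = q • (Y * D1) := by
  simp only [Y, qComm, mul_sub, sub_mul, mul_smul_comm, smul_mul_assoc]
  rw [← mul_assoc, D1_mul_B0, ← mul_assoc D1, D1_mul_Bm1, mul_assoc, D1_mul_Bm1, smul_mul_assoc,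
    mul_assoc Bm1, D1_mul_B0]
  simp only [mul_smul_comm, mul_assoc, smul_sub, smul_smul, mul_comm]

theorem Dd_mul_Z : Dd * Z = Z * Dd := by
  have h0 := q_ne_zero
  simp only [Z, qComm, mul_sub, sub_mul, mul_smul_comm, smul_mul_assoc]
  rw [← mul_assoc, Dd_mul_B1, ← mul_assoc Dd, Dd_mul_Y, smul_mul_assoc, smul_mul_assoc, mul_assoc,
    mul_assoc, Dd_mul_Y, Dd_mul_B1]
  simp only [mul_smul_comm, mul_assoc, smul_smul, mul_inv_cancel₀ h0, inv_mul_cancel₀ h0]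
  simp

theorem D1_mul_Z : D1 * Z = Z * D1 := by
  have h0 := q_ne_zero
  simp only [Z, qComm, mul_sub, sub_mul, mul_smul_comm, smul_mul_assoc]
  rw [← mul_assoc, D1_mul_B1, ← mul_assoc D1, D1_mul_Y, smul_mul_assoc, smul_mul_assoc, mul_assoc,
    mul_assoc, D1_mul_Y, D1_mul_B1]
  simp only [mul_smul_comm, mul_assoc, smul_smul, mul_inv_cancel₀ h0, inv_mul_cancel₀ h0]
  simp

/-! ### Lowering operators between eigenspaces of `B0` -/

/-- The part of the lowering operators that sends the `[k]`-eigenspace of `B0` to the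
`[k + ε]`-eigenspace, for `ε = 1` or `ε = -1`. -/
def G (ε k : ℤ) : U := (ε : Cq) • Y + q ^ (-(ε * k)) • Bm1

/-- The `m`-fold product of the operators `G`, starting at the `[k]`-eigenspace of `B0`. -/
def Gs (ε k : ℤ) : ℕ → U
  | 0 => 1
  | m + 1 => G ε (k + ε * m) * Gs ε k m

/-- This is the relation `Y * Bm1 = q • (Bm1 * Y)` in terms of ladder steps; it makes the lowered
vectors a grid rather than a tree. -/
theorem G_comm (k : ℤ) : G (-1) (k + 1) * G 1 k = G 1 (k - 1) * G (-1) k := by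
  have h0 := q_ne_zero
  simp only [G, mul_add, add_mul, smul_mul_assoc, mul_smul_comm, Y_mul_Bm1, smul_smul]
  match_scalars <;>
    simp only [neg_mul, one_mul, neg_neg, zpow_neg, neg_sub, neg_add, zpow_add₀ h0, zpow_sub₀ h0,
      zpow_one] <;>
    field_simp
  ring

section

variable {V : Type*} [AddCommGroup V] [Module Cq V] [Module U V] [IsScalarTower Cq U V]

/-- The vector `w` is a simultaneous eigenvector of `Dd`, `D1`, `B0`. -/
structure IsWt (d e k : ℤ) (w : V) : Prop where
  Dd_smul : Dd • w = q ^ d • w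
  D1_smul : D1 • w = q ^ e • w
  B0_smul : B0 • w = qInt k • w

theorem smul_scalar (u : U) (c : Cq) (w : V) : u • c • w = c • u • w := smul_comm u c w

theorem smul_smul_of_comm {a b : U} {c : Cq} (h : a * b = c • (b * a)) (w : V) :
    a • b • w = c • b • a • w := by
  rw [← mul_smul, h, smul_assoc, mul_smul]

theorem DdInv_smul {x : Cq} (hx : x ≠ 0) {w : V} (h : Dd • w = x • w) :
    DdInv • w = x⁻¹ • w := by
  rw [eq_inv_smul_iff₀ hx, smul_comm, ← h, ← mul_smul, DdInv_mul_Dd, one_smul]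

theorem D1Inv_smul {x : Cq} (hx : x ≠ 0) {w : V} (h : D1 • w = x • w) :
    D1Inv • w = x⁻¹ • w := by
  rw [eq_inv_smul_iff₀ hx, smul_comm, ← h, ← mul_smul, D1Inv_mul_D1, one_smul]

theorem H_smul {d e : ℤ} {w : V} (hd : Dd • w = q ^ d • w) (he : D1 • w = q ^ e • w) :
    H • w = qInt (d - e) • w := by
  have h0 := q_ne_zero
  rw [H, smul_assoc, sub_smul, mul_smul, mul_smul, DdInv_smul (zpow_ne_zero _ h0) hd,
    D1Inv_smul (zpow_ne_zero _ h0) he, smul_scalar Dd, smul_scalar D1, hd, he]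
  match_scalars
  simp only [qInt, zpow_neg, zpow_sub₀ h0]
  field_simp

theorem G_smul (ε k : ℤ) (w : V) :
    G ε k • w = (ε : Cq) • Y • w + q ^ (-(ε * k)) • Bm1 • w := by
  rw [G, add_smul, smul_assoc, smul_assoc]

theorem B0_smul_Y_smul (w : V) : B0 • Y • w = q • Y • B0 • w + Bm1 • w := by
  rw [← mul_smul, B0_mul_Y, add_smul, smul_assoc, mul_smul]

theorem B0_smul_Bm1_smul (w : V) : B0 • Bm1 • w = Y • w + q⁻¹ • Bm1 • B0 • w := by
  rw [← mul_smul, B0_mul_Bm1, add_smul, smul_assoc, mul_smul]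

theorem B1_smul_Bm1_smul (w : V) : B1 • Bm1 • w = Bm1 • B1 • w + H • w := by
  rw [← mul_smul, B1_mul_Bm1, add_smul, mul_smul]

theorem B1_smul_Y_smul (w : V) : B1 • Y • w = q⁻¹ • Y • B1 • w + Z • w := by
  rw [← mul_smul, B1_mul_Y, add_smul, smul_assoc, mul_smul]

theorem Z_smul_Bm1_smul (w : V) :
    Z • Bm1 • w = q • Bm1 • Z • w + q • H • Y • w - q⁻¹ • Y • H • w := by
  simp only [← mul_smul, Z_mul_Bm1, sub_smul, add_smul, smul_assoc]

theorem B0_smul_Z_smul (w : V) : B0 • Z • w = Z • B0 • w := by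
  rw [← mul_smul, B0_mul_Z, mul_smul]

namespace IsWt

variable {d e k : ℤ} {w : V}

/-- On `Y • w` and `Bm1 • w` the operator `B0` is given by a two by two matrix of trace `[2] [k]`
and determinant `[k] ^ 2 - 1`, hence with eigenvalues `[k + 1]` and `[k - 1]`. -/
theorem B0_G (hw : B0 • w = qInt k • w) {ε : ℤ} (hε : ε = 1 ∨ ε = -1) :
    B0 • G ε k • w = qInt (k + ε) • G ε k • w := by
  have h0 := q_ne_zero
  have h1 := q_sq_sub_one_ne_zero
  simp only [G_smul, smul_add, smul_scalar, B0_smul_Y_smul, B0_smul_Bm1_smul, hw]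
  generalize Y • w = y
  generalize Bm1 • w = f
  rcases hε with rfl | rfl <;> match_scalars <;> simp only [qInt, neg_mul, one_mul, neg_neg, zpow_neg, neg_add, zpow_add₀ h0,
      zpow_one] <;> field_simp <;> ring

protected theorem Y (hd : Dd • w = q ^ d • w) (he : D1 • w = q ^ e • w) :
    Dd • Y • w = q ^ (d - 1) • Y • w ∧ D1 • Y • w = q ^ (e + 1) • Y • w := by
  have h0 := q_ne_zero
  constructor
  · rw [smul_smul_of_comm Dd_mul_Y, hd, smul_scalar Y, smul_smul, zpow_sub_one₀ h0, mul_comm]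
  · rw [smul_smul_of_comm D1_mul_Y, he, smul_scalar Y, smul_smul, zpow_add_one₀ h0, mul_comm]

protected theorem Bm1 (hd : Dd • w = q ^ d • w) (he : D1 • w = q ^ e • w) :
    Dd • Bm1 • w = q ^ (d - 1) • Bm1 • w ∧ D1 • Bm1 • w = q ^ (e + 1) • Bm1 • w := by
  have h0 := q_ne_zero
  constructor
  · rw [smul_smul_of_comm Dd_mul_Bm1, hd, smul_scalar Bm1, smul_smul, zpow_sub_one₀ h0, mul_comm]
  · rw [smul_smul_of_comm D1_mul_Bm1, he, smul_scalar Bm1, smul_smul, zpow_add_one₀ h0, mul_comm]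

protected theorem G (hw : IsWt d e k w) {ε : ℤ} (hε : ε = 1 ∨ ε = -1) :
    IsWt (d - 1) (e + 1) (k + ε) (G ε k • w) where
  Dd_smul := by
    rw [G_smul, smul_add, smul_scalar Dd, smul_scalar Dd, (IsWt.Y hw.1 hw.2).1,
      (IsWt.Bm1 hw.1 hw.2).1, smul_add, smul_comm (ε : Cq), smul_comm (q ^ (-(ε * k)))]
  D1_smul := by
    rw [G_smul, smul_add, smul_scalar D1, smul_scalar D1, (IsWt.Y hw.1 hw.2).2,
      (IsWt.Bm1 hw.1 hw.2).2, smul_add, smul_comm (ε : Cq), smul_comm (q ^ (-(ε * k)))]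
  B0_smul := B0_G hw.3 hε

protected theorem Gs (hw : IsWt d e k w) {ε : ℤ} (hε : ε = 1 ∨ ε = -1) (m : ℕ) :
    IsWt (d - m) (e + m) (k + ε * m) (Gs ε k m • w) := by
  induction m with
  | zero => simpa [Gs] using hw
  | succ m ih =>
    rw [Gs, mul_smul]
    convert ih.G hε using 1 <;> push_cast <;> ring

protected theorem Z (hw : IsWt d e k w) : IsWt d e k (Z • w) where
  Dd_smul := by rw [← mul_smul, Dd_mul_Z, mul_smul, hw.1, smul_comm]
  D1_smul := by rw [← mul_smul, D1_mul_Z, mul_smul, hw.2, smul_comm]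
  B0_smul := by rw [B0_smul_Z_smul, hw.3, smul_comm]

theorem Z_Bm1 (hw : IsWt d e k w) :
    Z • Bm1 • w = q • Bm1 • Z • w - (qInt 2 * q ^ (1 - (d - e))) • Y • w := by
  have h0 := q_ne_zero
  have h1 := q_sq_sub_one_ne_zero
  have h := IsWt.Y hw.1 hw.2
  rw [Z_smul_Bm1_smul, H_smul hw.1 hw.2, H_smul h.1 h.2, smul_scalar Y]
  generalize Y • w = y
  generalize Bm1 • Z • w = f
  match_scalars
  · simp
  · simp only [qInt_two, show d - 1 - (e + 1) = (d - e) - 1 - 1 by ring]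
    generalize d - e = c
    simp only [qInt, zpow_neg, zpow_sub₀ h0, zpow_one]
    field_simp
    ring

/-- Since `Y` is a twisted commutator of `B0` and `Bm1`, and `Z` commutes with `B0`, the formula for
`Bm1` carries over. -/
theorem Z_Y (hw : IsWt d e k w) :
    Z • Y • w = q • Y • Z • w -
      (qInt 2 * q ^ (1 - (d - e))) • (Bm1 • w + ((q - q⁻¹) * qInt k) • Y • w) := by
  have h0 := q_ne_zero
  have h1 : Y • w = B0 • Bm1 • w - q⁻¹ • Bm1 • B0 • w := by rw [B0_smul_Bm1_smul]; abel
  nth_rewrite 1 [h1]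
  rw [smul_sub, ← B0_smul_Z_smul, hw.Z_Bm1, hw.3, smul_scalar Z, smul_scalar Bm1, smul_scalar Z,
    hw.Z_Bm1]
  simp only [smul_sub, smul_scalar, B0_smul_Bm1_smul, B0_smul_Y_smul, hw.3, hw.Z.3]
  generalize Y • w = y
  generalize Bm1 • w = f
  generalize Y • Z • w = y'
  generalize Bm1 • Z • w = f'
  match_scalars <;> field_simp <;> ring

/-- The correction terms for `Y` and `Bm1` recombine into a multiple of the same `G`, so
eigenvectors of `Z` stay eigenvectors along a ladder. -/
theorem Z_G (hw : IsWt d e k w) {ε : ℤ} (hε : ε = 1 ∨ ε = -1) :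
    Z • G ε k • w =
      G ε k • (q • Z • w - (ε * qInt 2 * q ^ (ε * k + 1 - (d - e))) • w) := by
  have h0 := q_ne_zero
  have h1 := q_sq_sub_one_ne_zero
  simp only [G_smul, smul_add, smul_sub, smul_scalar, hw.Z_Y, hw.Z_Bm1, qInt_two]
  generalize Y • w = y
  generalize Bm1 • w = f
  generalize Y • Z • w = y'
  generalize Bm1 • Z • w = f'
  generalize d - e = c
  rcases hε with rfl | rfl <;> match_scalars <;> simp only [qInt, neg_mul, one_mul, neg_neg, zpow_neg, neg_add, zpow_add₀ h0, zpow_sub₀ h0,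
      zpow_one] <;> field_simp <;> ring

theorem Z_Gs (hw : IsWt d e k w) {ε : ℤ} (hε : ε = 1 ∨ ε = -1) (m : ℕ) :
    Z • Gs ε k m • w = Gs ε k m • (q ^ (m : ℤ) • Z • w -
      (ε * qInt 2 * q ^ (ε * k - (d - e) + 2 * m - 1) * qInt m) • w) := by
  have h0 := q_ne_zero
  have h1 := q_sq_sub_one_ne_zero
  induction m with
  | zero => simp [Gs, qInt_zero]
  | succ m ih =>
    have hε2 : ε * ε = 1 := by rcases hε with rfl | rfl <;> rfl
    rw [Gs, mul_smul, mul_smul, (hw.Gs hε m).Z_G hε, ih, ← smul_scalar _ q, ← smul_scalar (Gs ε k m) (_ * _ * _),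
      ← smul_sub]
    congr 2
    generalize Z • w = z
    rw [show ε * (k + ε * m) + 1 - (d - m - (e + m)) = ε * k - (d - e) + m + m + m + 1 by
      linear_combination (m : ℤ) * hε2]
    generalize ε * k - (d - e) = c
    push_cast
    match_scalars
    · rw [zpow_add_one₀ h0]; ring
    · simp only [qInt_two, mul_add, two_mul, mul_one]
      simp only [qInt, zpow_neg, zpow_sub₀ h0, zpow_add₀ h0, zpow_one]
      field_simp
      ring

/-- Where a ladder stops, the left side vanishes, and this constrains the action of `Z` on `w`: the
source of the dominance condition. The induction moves `B1` past one more `G`; the resulting `Z` and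
`H` act on the lowered vector through `Z_Gs` and `H_smul`. -/
theorem B1_Gs (hw : IsWt d e k w) (h : B1 • w = 0) {ε : ℤ} (hε : ε = 1 ∨ ε = -1) (m : ℕ) :
    B1 • Gs ε k (m + 1) • w = qInt (m + 1) • Gs ε k m • ((ε : Cq) • Z • w +
      (q ^ (-(d - e)) * qInt (ε * k) + qInt (d - e - ε * k - 2 * m)) • w) := by
  have h0 := q_ne_zero
  have h1 := q_sq_sub_one_ne_zero
  have hε2 : ε * ε = 1 := by rcases hε with rfl | rfl <;> rfl
  have key (j : ℤ) (x : V) : B1 • G ε j • x = ((ε : Cq) * q⁻¹) • Y • B1 • x + (ε : Cq) • Z • x +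
      q ^ (-(ε * j)) • (Bm1 • B1 • x + H • x) := by
    rw [G_smul, smul_add, smul_scalar B1, smul_scalar B1, B1_smul_Y_smul, B1_smul_Bm1_smul, smul_add, smul_smul, smul_smul]
  induction m with
  | zero =>
    simp only [Gs, mul_one, key, h, smul_zero, H_smul hw.1 hw.2, zero_add, one_smul]
    generalize d - e = c
    simp only [Nat.cast_zero, mul_zero, add_zero, zero_add, qInt_one, one_smul, sub_zero]
    congr 1
    generalize ε * k = j
    match_scalars
    simp only [qInt, zpow_neg, zpow_sub₀ h0]
    field_simp
    ring
  | succ m ih =>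
    have hm := hw.Gs hε (m + 1)
    set u := (ε : Cq) • Z • w +
      (q ^ (-(d - e)) * qInt (ε * k) + qInt (d - e - ε * k - 2 * m)) • w with hu
    clear_value u
    -- Passing `B1` through contributes `q⁻¹` to the `Y` term, while the level shifted by `ε`
    -- contributes `q⁻¹` to the `Bm1` term (as `ε * ε = 1`), so both reassemble into one more `G`.
    have e1 : ((ε : Cq) * q⁻¹) • Y • Gs ε k m • u +
        q ^ (-(ε * (k + ε * (m + 1 : ℕ)))) • Bm1 • Gs ε k m • u =
        q⁻¹ • Gs ε k (m + 1) • u := by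
      rw [Gs, mul_smul (G _ _), G_smul, smul_add, smul_smul (q⁻¹), smul_smul (q⁻¹), mul_comm, ← zpow_neg_one,
        ← zpow_add₀ h0]
      congr 3
      push_cast
      linear_combination (-1 : ℤ) * hε2
    rw [Gs, mul_smul, key, ih, H_smul hm.1 hm.2, hw.Z_Gs hε, smul_scalar Y, smul_scalar Bm1]
    trans Gs ε k (m + 1) • (qInt (m + 1) • q⁻¹ • u + (ε : Cq) • (q ^ ((m + 1 : ℕ) : ℤ) • Z • w -
      (ε * qInt 2 * q ^ (ε * k - (d - e) + 2 * (m + 1 : ℕ) - 1) * qInt (m + 1 : ℕ)) • w) +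
      (q ^ (-(ε * (k + ε * (m + 1 : ℕ)))) *
        qInt (d - (m + 1 : ℕ) - (e + (m + 1 : ℕ)))) • w)
    · simp only [smul_add, smul_scalar _ (qInt (m + 1)), smul_scalar _ q⁻¹, ← e1,
        smul_scalar _ (ε : Cq), smul_scalar _ (_ * _ : Cq)]
      generalize Gs ε k (m + 1) • (_ - _ : V) = x1
      generalize Gs ε k (m + 1) • w = x2
      generalize Y • (_ : V) = x3
      generalize Bm1 • (_ : V) = x4
      module
    · rw [← smul_scalar (Gs ε k (m + 1))]
      congr 1
      rw [hu]
      generalize Z • w = z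
      have hεc : (ε : Cq) * ε = 1 := by exact_mod_cast hε2
      rw [show ε * (k + ε * (m + 1 : ℕ)) = ε * k + (m + 1 : ℕ) by
        linear_combination ((m + 1 : ℕ) : ℤ) * hε2,
        show d - ((m + 1 : ℕ) : ℤ) - (e + (m + 1 : ℕ)) = d - e - (m + 1) - (m + 1) by
          push_cast; ring]
      generalize ε * k = j
      generalize d - e = c
      push_cast
      match_scalars
      · simp only [qInt, zpow_neg, zpow_add₀ h0, zpow_one]
        field_simp
        ring
      · simp only [two_mul, mul_one, qInt_two]
        have : (ε : Cq) ^ 2 = 1 := by rw [pow_two, hεc]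
        simp only [qInt, zpow_neg, zpow_sub₀ h0, zpow_add₀ h0, zpow_one]
        field_simp
        rw [this]
        ring

end IsWt

end

section

variable {V : Type*} [AddCommGroup V] [Module Cq V] [Module U V] [IsScalarTower Cq U V]

/-! ### Submodules and weight spaces -/

theorem smul_mem_of_gens (T : Submodule Cq V) (h : ∀ g, ∀ x ∈ T, cls g • x ∈ T) (u : U) :
    ∀ x ∈ T, u • x ∈ T := by
  obtain ⟨a, rfl⟩ := RingQuot.mkAlgHom_surjective Cq Rel u
  induction a using FreeAlgebra.induction with
  | grade0 r =>
    intro x hx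
    rw [AlgHom.commutes, algebraMap_smul]
    exact T.smul_mem r hx
  | grade1 g => exact h g
  | mul a b ha hb =>
    intro x hx
    rw [map_mul, mul_smul]
    exact ha _ (hb _ hx)
  | add a b ha hb =>
    intro x hx
    rw [map_add, add_smul]
    exact T.add_mem (ha _ hx) (hb _ hx)

theorem act_apply (u : U) (x : V) : act V u x = u • x := rfl

theorem mem_weightSpace {w : Cq × Cq × Cq × Cq} {x : V} : x ∈ weightSpace V w ↔
    Dd • x = w.1 • x ∧ D1 • x = w.2.1 • x ∧ B0 • x = w.2.2.1 • x ∧ Z • x = w.2.2.2 • x := by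
  simp only [weightSpace, Submodule.mem_inf, Module.End.mem_eigenspace_iff, act_apply, and_assoc]

theorem act_commute {a b : U} (h : a * b = b * a) : Commute (act V a) (act V b) :=
  Commute.map (f := Algebra.lsmul Cq Cq V) h

variable (V) in
theorem iSupIndep_weightSpace : iSupIndep (weightSpace V) := by
  let f : Fin 4 → Module.End Cq V := ![act V Dd, act V D1, act V B0, act V Z]
  have hf : ∀ i j, Commute (f i) (f j) := by
    intro i j
    fin_cases i <;> fin_cases j
    · exact Commute.refl _
    · exact act_commute Dd_mul_D1
    · exact act_commute Dd_mul_B0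
    · exact act_commute Dd_mul_Z
    · exact act_commute Dd_mul_D1.symm
    · exact Commute.refl _
    · exact act_commute D1_mul_B0
    · exact act_commute D1_mul_Z
    · exact act_commute Dd_mul_B0.symm
    · exact act_commute D1_mul_B0.symm
    · exact Commute.refl _
    · exact act_commute B0_mul_Z
    · exact act_commute Dd_mul_Z.symm
    · exact act_commute D1_mul_Z.symm
    · exact act_commute B0_mul_Z.symm
    · exact Commute.refl _
  have h := Module.End.independent_iInf_maxGenEigenspace_of_forall_mapsTo f
    fun i j φ => Module.End.mapsTo_maxGenEigenspace_of_comm (hf j i) φ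
  have hinj : Function.Injective fun w : Cq × Cq × Cq × Cq =>
      (![w.1, w.2.1, w.2.2.1, w.2.2.2] : Fin 4 → Cq) := by
    rintro ⟨a, b, c, d⟩ ⟨a', b', c', d'⟩ h
    have h0 := congrFun h 0
    have h1 := congrFun h 1
    have h2 := congrFun h 2
    have h3 := congrFun h 3
    simp at h0 h1 h2 h3
    simp [h0, h1, h2, h3]
  refine (h.comp hinj).mono fun w x hx => ?_
  have hm (g : Module.End Cq V) (c : Cq) : g.eigenspace c ≤ g.maxGenEigenspace c :=
    (g.genEigenspace c).monotone le_top
  simp only [Function.comp_apply, Submodule.mem_iInf]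
  simp only [weightSpace, Submodule.mem_inf] at hx
  intro i
  fin_cases i
  · exact hm _ _ hx.1.1.1
  · exact hm _ _ hx.1.1.2
  · exact hm _ _ hx.1.2
  · exact hm _ _ hx.2

/-- A module spanned by vectors of pairwise different weights is the direct sum of its weight
spaces, which are lines. -/
theorem isSumOfWeightLines_of_span {ι : Type*} (x : ι → V) (wt : ι → Cq × Cq × Cq × Cq)
    (hwt : Function.Injective wt) (hx : ∀ i, x i ∈ weightSpace V (wt i))
    (hspan : Submodule.span Cq (Set.range x) = ⊤) : IsSumOfWeightLines V where
  independent := iSupIndep_weightSpace V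
  iSup_eq_top := by
    rw [← top_le_iff, ← hspan, Submodule.span_le]
    rintro _ ⟨i, rfl⟩
    exact Submodule.mem_iSup_of_mem (wt i) (hx i)
  finrank_eq_one := by
    intro w hw
    have hind := iSupIndep_weightSpace V w
    by_cases hi : ∃ i, wt i = w
    · obtain ⟨i, rfl⟩ := hi
      -- Every spanning vector other than `x i` lies in a different weight space, so independence
      -- leaves only multiples of `x i` in this one.
      have htop : Submodule.span Cq {x i} ⊔ ⨆ (w') (_ : w' ≠ wt i), weightSpace V w' = ⊤ := by
        rw [← top_le_iff, ← hspan, Submodule.span_le]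
        rintro _ ⟨j, rfl⟩
        by_cases hj : j = i
        · subst hj
          exact Submodule.mem_sup_left (Submodule.mem_span_singleton_self _)
        · exact Submodule.mem_sup_right (Submodule.mem_iSup_of_mem (wt j)
            (Submodule.mem_iSup_of_mem (fun h => hj (hwt h)) (hx j)))
      have heq : weightSpace V (wt i) = Submodule.span Cq {x i} := by
        refine le_antisymm (fun y hy => ?_) ?_
        · have hy' : y ∈ Submodule.span Cq {x i} ⊔ ⨆ (w') (_ : w' ≠ wt i), weightSpace V w' := by
            rw [htop]; trivial
          obtain ⟨a, ha, b, hb, rfl⟩ := Submodule.mem_sup.mp hy'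
          have ha' : a ∈ weightSpace V (wt i) := by
            obtain ⟨c, rfl⟩ := Submodule.mem_span_singleton.mp ha
            exact Submodule.smul_mem _ _ (hx i)
          have hb' : b ∈ weightSpace V (wt i) := by
            simpa using Submodule.sub_mem _ hy ha'
          have : b = 0 := by simpa using (hind.le_bot ⟨hb', hb⟩)
          rw [this, add_zero]
          exact ha
        · rw [Submodule.span_singleton_le_iff_mem]
          exact hx i
      rw [heq] at hw ⊢
      exact finrank_span_singleton fun h => hw (by rw [h, Submodule.span_zero_singleton])
    · exfalso
      have htop : ⨆ (w') (_ : w' ≠ w), weightSpace V w' = ⊤ := by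
        rw [← top_le_iff, ← hspan, Submodule.span_le]
        rintro _ ⟨j, rfl⟩
        exact Submodule.mem_iSup_of_mem (wt j)
          (Submodule.mem_iSup_of_mem (fun h => hi ⟨j, h⟩) (hx j))
      rw [htop, disjoint_top] at hind
      exact hw hind

/-- A module spanned by eigenvectors of `u` with eigenvalues in `S`. -/
theorem diagonalizableIn_of_span {ι : Type*} (x : ι → V) (u : U) (S : Set Cq)
    (hx : ∀ i, ∃ c ∈ S, u • x i = c • x i)
    (hspan : Submodule.span Cq (Set.range x) = ⊤) : DiagonalizableIn V u S := by
  rw [DiagonalizableIn, ← top_le_iff, ← hspan, Submodule.span_le]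
  rintro _ ⟨i, rfl⟩
  obtain ⟨c, hc, h⟩ := hx i
  exact Submodule.mem_iSup_of_mem c
    (Submodule.mem_iSup_of_mem hc (Module.End.mem_eigenspace_iff.mpr h))

/-! ### Modules generated by a maximal vector -/

/-- The vectors obtained from `v`, of `B0`-eigenvalue `[n]`, by applying lowering operators. -/
def lowered (n : ℤ) (v : V) (p : ℕ × ℕ) : V := Gs (-1) (n + p.1) p.2 • Gs 1 n p.1 • v

variable {d e n : ℤ} {v : V}

theorem lowered_zero : lowered n v (0, 0) = v := by simp [lowered, Gs]

theorem IsWt.lowered (hv : IsWt d e n v) (p : ℕ × ℕ) :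
    IsWt (d - (p.1 + p.2 : ℕ)) (e + (p.1 + p.2 : ℕ)) (n + p.1 - p.2) (lowered n v p) := by
  have h1 := hv.Gs (.inl rfl) p.1
  rw [one_mul] at h1
  have h2 := h1.Gs (.inr rfl) p.2
  unfold QSP.lowered
  convert h2 using 1 <;> push_cast <;> ring

theorem IsWt.Z_Gs_eigen {k : ℤ} {w : V} (hw : IsWt d e k w) {ε : ℤ} (hε : ε = 1 ∨ ε = -1) (m : ℕ)
    {z : Cq} (hz : Z • w = z • w) : ∃ z' : Cq, Z • Gs ε k m • w = z' • Gs ε k m • w := by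
  rw [hw.Z_Gs hε, hz, smul_smul, ← sub_smul, smul_scalar]
  exact ⟨_, rfl⟩

theorem IsWt.Z_lowered (hv : IsWt d e n v) {ζ : Cq} (hζ : Z • v = ζ • v) (p : ℕ × ℕ) :
    ∃ z : Cq, Z • QSP.lowered n v p = z • QSP.lowered n v p := by
  have h1 := hv.Gs (.inl rfl) p.1
  rw [one_mul] at h1
  obtain ⟨z, hz⟩ := hv.Z_Gs_eigen (.inl rfl) p.1 hζ
  exact h1.Z_Gs_eigen (.inr rfl) p.2 hz

theorem Gm_lowered (a b : ℕ) : G (-1) (n + a - b) • lowered n v (a, b) = lowered n v (a, b + 1) := by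
  simp only [lowered, Gs, mul_smul (G _ _)]
  congr 2
  ring

/-- In `lowered` the plus steps come first, so a new plus step has to be commuted past the minus
steps. -/
theorem Gp_lowered (a b : ℕ) : G 1 (n + a - b) • lowered n v (a, b) = lowered n v (a + 1, b) := by
  induction b with
  | zero => simp [lowered, Gs, mul_smul]
  | succ b ih =>
    rw [← Gm_lowered, ← Gm_lowered, ← ih, ← mul_smul, ← mul_smul]
    have h := G_comm (n + a - b)
    rw [show n + (a : ℤ) - (b + 1 : ℕ) = n + a - b - 1 by push_cast; ring, ← h]
    congr 3
    push_cast
    ring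

theorem Bm1_smul_eq (k : ℤ) (x : V) :
    Bm1 • x = (qCosh k)⁻¹ • (G 1 k • x + G (-1) k • x) := by
  rw [eq_inv_smul_iff₀ (qCosh_ne_zero k), G_smul, G_smul, qCosh]
  generalize Bm1 • x = f
  generalize Y • x = y
  match_scalars <;> simp [add_comm]

theorem Y_smul_eq (k : ℤ) (x : V) :
    Y • x = (qCosh k)⁻¹ • (q ^ k • G 1 k • x - q ^ (-k) • G (-1) k • x) := by
  have h0 := q_ne_zero
  rw [eq_inv_smul_iff₀ (qCosh_ne_zero k), G_smul, G_smul, qCosh]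
  generalize Bm1 • x = f
  generalize Y • x = y
  match_scalars
  · simp
  · have : q ^ k ≠ 0 := zpow_ne_zero _ h0
    simp only [zpow_neg, one_mul, neg_mul, neg_neg]
    field_simp
    ring

/-- Stability suffices here, without a formula for `B1` on the grid: moving `B1` past `G` leaves
only `Bm1`, `Y`, `H`, `Z` applied to `x` or to `B1 • x`. -/
theorem B1_smul_G_mem {T : Submodule Cq V} (hF : ∀ x ∈ T, Bm1 • x ∈ T) (hY : ∀ x ∈ T, Y • x ∈ T)
    (hH : ∀ x ∈ T, H • x ∈ T) (hZ : ∀ x ∈ T, Z • x ∈ T) (ε k : ℤ) {x : V}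
    (hx : x ∈ T) (hEx : B1 • x ∈ T) : G ε k • x ∈ T ∧ B1 • G ε k • x ∈ T := by
  rw [G_smul, smul_add, smul_scalar B1, smul_scalar B1, B1_smul_Y_smul, B1_smul_Bm1_smul]
  exact ⟨T.add_mem (T.smul_mem _ (hY _ hx)) (T.smul_mem _ (hF _ hx)),
    T.add_mem (T.smul_mem _ (T.add_mem (T.smul_mem _ (hY _ hEx)) (hZ _ hx)))
      (T.smul_mem _ (T.add_mem (hF _ hEx) (hH _ hx)))⟩

theorem B1_smul_Gs_mem {T : Submodule Cq V} (hF : ∀ x ∈ T, Bm1 • x ∈ T) (hY : ∀ x ∈ T, Y • x ∈ T)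
    (hH : ∀ x ∈ T, H • x ∈ T) (hZ : ∀ x ∈ T, Z • x ∈ T) (ε k : ℤ) (m : ℕ) {x : V}
    (hx : x ∈ T) (hEx : B1 • x ∈ T) : Gs ε k m • x ∈ T ∧ B1 • Gs ε k m • x ∈ T := by
  induction m with
  | zero => simpa [Gs] using ⟨hx, hEx⟩
  | succ m ih =>
    rw [Gs, mul_smul]
    exact B1_smul_G_mem hF hY hH hZ ε _ ih.1 ih.2

theorem smul_mem_of_eigen {ι : Type*} {x : ι → V} {u : U} (h : ∀ i, ∃ c : Cq, u • x i = c • x i) :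
    ∀ y ∈ Submodule.span Cq (Set.range x), u • y ∈ Submodule.span Cq (Set.range x) := by
  intro y hy
  induction hy using Submodule.span_induction with
  | mem y hy =>
    obtain ⟨i, rfl⟩ := hy
    obtain ⟨c, hc⟩ := h i
    rw [hc]
    exact Submodule.smul_mem _ _ (Submodule.subset_span ⟨i, rfl⟩)
  | zero => rw [smul_zero]; exact Submodule.zero_mem _
  | add y z _ _ hy hz => rw [smul_add]; exact Submodule.add_mem _ hy hz
  | smul c y _ hy => rw [smul_scalar]; exact Submodule.smul_mem _ _ hy

theorem span_lowered_eq_top (hv : IsWt d e n v) (hE : B1 • v = 0) {ζ : Cq} (hζ : Z • v = ζ • v)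
    (hgen : Submodule.span U {v} = ⊤) : Submodule.span Cq (Set.range (lowered n v)) = ⊤ := by
  have h0 := q_ne_zero
  set T := Submodule.span Cq (Set.range (lowered n v)) with hT
  have hmem (p) : lowered n v p ∈ T := Submodule.subset_span ⟨p, rfl⟩
  have hind (u : U) (h : ∀ p, u • lowered n v p ∈ T) : ∀ x ∈ T, u • x ∈ T := by
    intro x hx
    induction hx using Submodule.span_induction with
    | mem y hy => obtain ⟨i, rfl⟩ := hy; exact h i
    | zero => rw [smul_zero]; exact Submodule.zero_mem _
    | add y z _ _ hy hz => rw [smul_add]; exact Submodule.add_mem _ hy hz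
    | smul c y _ hy => rw [smul_scalar]; exact Submodule.smul_mem _ _ hy
  have hF : ∀ x ∈ T, Bm1 • x ∈ T := by
    refine hind _ fun p => ?_
    rw [Bm1_smul_eq (n + p.1 - p.2), Gp_lowered, Gm_lowered]
    exact T.smul_mem _ (T.add_mem (hmem _) (hmem _))
  have hY : ∀ x ∈ T, Y • x ∈ T := by
    refine hind _ fun p => ?_
    rw [Y_smul_eq (n + p.1 - p.2), Gp_lowered, Gm_lowered]
    exact T.smul_mem _ (T.sub_mem (T.smul_mem _ (hmem _)) (T.smul_mem _ (hmem _)))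
  have hH : ∀ x ∈ T, H • x ∈ T :=
    smul_mem_of_eigen fun p => ⟨_, H_smul (hv.lowered p).1 (hv.lowered p).2⟩
  have hZ : ∀ x ∈ T, Z • x ∈ T := smul_mem_of_eigen (hv.Z_lowered hζ)
  have hB1 : ∀ x ∈ T, B1 • x ∈ T := by
    refine hind _ fun p => ?_
    have hvT : v ∈ T := by
      have := hmem (0, 0)
      rwa [lowered_zero] at this
    have h1 := B1_smul_Gs_mem hF hY hH hZ 1 n p.1 hvT (by rw [hE]; exact T.zero_mem)
    exact (B1_smul_Gs_mem hF hY hH hZ (-1) (n + p.1) p.2 h1.1 h1.2).2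
  have hU (u : U) := smul_mem_of_gens T (fun g => by
    cases g with
    | B0 => exact smul_mem_of_eigen fun p => ⟨_, (hv.lowered p).3⟩
    | B1 => exact hB1
    | Bm1 => exact hF
    | Dd => exact smul_mem_of_eigen fun p => ⟨_, (hv.lowered p).1⟩
    | DdInv => exact smul_mem_of_eigen fun p =>
        ⟨_, DdInv_smul (zpow_ne_zero _ h0) (hv.lowered p).1⟩
    | D1 => exact smul_mem_of_eigen fun p => ⟨_, (hv.lowered p).2⟩
    | D1Inv => exact smul_mem_of_eigen fun p =>
        ⟨_, D1Inv_smul (zpow_ne_zero _ h0) (hv.lowered p).2⟩) u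
  rw [← top_le_iff]
  intro x _
  have hx : x ∈ Submodule.span U {v} := by rw [hgen]; trivial
  obtain ⟨u, rfl⟩ := Submodule.mem_span_singleton.mp hx
  have := hmem (0, 0)
  rw [lowered_zero] at this
  exact hU u _ this

theorem isSumOfWeightLines_of_maximal (hv : IsWt d e n v) (hE : B1 • v = 0) {ζ : Cq}
    (hζ : Z • v = ζ • v) (hgen : Submodule.span U {v} = ⊤) : IsSumOfWeightLines V := by
  choose z hz using hv.Z_lowered hζ
  refine isSumOfWeightLines_of_span (lowered n v)
    (fun p => (q ^ (d - (p.1 + p.2 : ℕ)), q ^ (e + (p.1 + p.2 : ℕ)), qInt (n + p.1 - p.2), z p))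
    ?_ (fun p => ?_) (span_lowered_eq_top hv hE hζ hgen)
  -- The `Dd`-weight gives `a + b` and the `B0`-weight gives `a - b`.
  · rintro ⟨a, b⟩ ⟨a', b'⟩ h
    simp only [Prod.mk.injEq] at h
    have h1 := q_zpow_injective h.1
    have h2 := qInt_injective h.2.2.1
    push_cast at h1
    ext <;> simp <;> omega
  · have h := hv.lowered p
    exact mem_weightSpace.mpr ⟨h.1, h.2, h.3, hz p⟩

theorem isRational_of_maximal [Module.Finite Cq V] (hv : IsWt d e n v) (hE : B1 • v = 0) {ζ : Cq}
    (hζ : Z • v = ζ • v) (hgen : Submodule.span U {v} = ⊤) : IsRational V where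
  finite := inferInstance
  diag_B0 := diagonalizableIn_of_span _ _ _
    (fun p => ⟨_, ⟨_, rfl⟩, (hv.lowered p).3⟩) (span_lowered_eq_top hv hE hζ hgen)
  diag_Dd := diagonalizableIn_of_span _ _ _
    (fun p => ⟨_, ⟨_, rfl⟩, (hv.lowered p).1⟩) (span_lowered_eq_top hv hE hζ hgen)
  diag_D1 := diagonalizableIn_of_span _ _ _
    (fun p => ⟨_, ⟨_, rfl⟩, (hv.lowered p).2⟩) (span_lowered_eq_top hv hE hζ hgen)

/-! ### The top weight line and proper submodules -/

/-- A polynomial in `Dd` that kills the eigenvectors with eigenvalue `q ^ (d - j)`, `1 ≤ j ≤ J`. -/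
def lowerKiller (d : ℤ) : ℕ → U
  | 0 => 1
  | J + 1 => (Dd - algebraMap Cq U (q ^ (d - (J + 1 : ℕ)))) * lowerKiller d J

theorem lowerKiller_smul {c : ℤ} {x : V} (hx : Dd • x = q ^ c • x) (J : ℕ) :
    lowerKiller d J • x = (∏ j ∈ Finset.range J, (q ^ c - q ^ (d - (j + 1 : ℕ)))) • x := by
  induction J with
  | zero => simp [lowerKiller]
  | succ J ih =>
    rw [lowerKiller, mul_smul, ih, smul_scalar, sub_smul, hx, algebraMap_smul, ← sub_smul,
      smul_smul, Finset.prod_range_succ]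

theorem lowerKiller_smul_eq_zero {m J : ℕ} (h1 : 1 ≤ m) (h2 : m ≤ J) {x : V}
    (hx : Dd • x = q ^ (d - (m : ℤ)) • x) : lowerKiller d J • x = 0 := by
  rw [lowerKiller_smul hx, Finset.prod_eq_zero (i := m - 1) (Finset.mem_range.mpr (by omega)),
    zero_smul]
  rw [Nat.sub_add_cancel h1, sub_self]

theorem lowerKiller_smul_top (hv : Dd • v = q ^ d • v) (J : ℕ) :
    ∃ c : Cq, c ≠ 0 ∧ lowerKiller d J • v = c • v := by
  refine ⟨_, Finset.prod_ne_zero_iff.mpr fun j _ => ?_, lowerKiller_smul hv J⟩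
  rw [sub_ne_zero]
  intro h
  have := q_zpow_injective h
  push_cast at this
  omega

/-- The span of the weight vectors strictly below `v`. -/
def belowSpan (n : ℤ) (v : V) : Submodule Cq V :=
  Submodule.span Cq (lowered n v '' {p | 1 ≤ p.1 + p.2})

theorem exists_lowerKiller (hv : IsWt d e n v) {x : V} (hx : x ∈ belowSpan n v) :
    ∃ J, ∀ J' ≥ J, lowerKiller d J' • x = 0 := by
  induction hx using Submodule.span_induction with
  | mem y hy =>
    obtain ⟨p, hp, rfl⟩ := hy
    exact ⟨p.1 + p.2, fun J hJ => lowerKiller_smul_eq_zero hp hJ (hv.lowered p).1⟩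
  | zero => exact ⟨0, fun J _ => smul_zero _⟩
  | add y z _ _ hy hz =>
    obtain ⟨J, hJ⟩ := hy
    obtain ⟨J', hJ'⟩ := hz
    exact ⟨max J J', fun I hI => by
      rw [smul_add, hJ I (le_trans (le_max_left _ _) hI), hJ' I (le_trans (le_max_right _ _) hI),
        add_zero]⟩
  | smul c y _ hy =>
    obtain ⟨J, hJ⟩ := hy
    exact ⟨J, fun I hI => by rw [smul_scalar, hJ I hI, smul_zero]⟩

/-- A long enough `lowerKiller` annihilates a vector below `v` but multiplies `v` by a nonzero
scalar. -/
theorem notMem_belowSpan (hv : IsWt d e n v) (hv0 : v ≠ 0) : v ∉ belowSpan n v := by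
  intro h
  obtain ⟨J, hJ⟩ := exists_lowerKiller hv h
  obtain ⟨c, hc, h⟩ := lowerKiller_smul_top hv.1 J
  rw [hJ J le_rfl] at h
  exact (smul_ne_zero hc hv0) h.symm

theorem exists_eq_smul_add (hv : IsWt d e n v) (hE : B1 • v = 0) {ζ : Cq}
    (hζ : Z • v = ζ • v) (hgen : Submodule.span U {v} = ⊤) (x : V) :
    ∃ c : Cq, ∃ y ∈ belowSpan n v, x = c • v + y := by
  have hx : x ∈ Submodule.span Cq {v} ⊔ belowSpan n v := by
    have : (⊤ : Submodule Cq V) ≤ Submodule.span Cq {v} ⊔ belowSpan n v := by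
      rw [← span_lowered_eq_top hv hE hζ hgen, Submodule.span_le]
      rintro _ ⟨⟨a, b⟩, rfl⟩
      by_cases h : 1 ≤ a + b
      · exact Submodule.mem_sup_right (Submodule.subset_span ⟨_, h, rfl⟩)
      · obtain ⟨rfl, rfl⟩ : a = 0 ∧ b = 0 := by omega
        rw [lowered_zero]
        exact Submodule.mem_sup_left (Submodule.mem_span_singleton_self _)
    exact this trivial
  obtain ⟨a, ha, b, hb, rfl⟩ := Submodule.mem_sup.mp hx
  obtain ⟨c, rfl⟩ := Submodule.mem_span_singleton.mp ha
  exact ⟨c, b, hb, rfl⟩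

/-- Applying `lowerKiller` isolates the component along `v`; were it nonzero, `N` would contain the
generator. -/
theorem mem_belowSpan_of_mem (hv : IsWt d e n v) (hE : B1 • v = 0) {ζ : Cq}
    (hζ : Z • v = ζ • v) (hgen : Submodule.span U {v} = ⊤) {N : Submodule U V} (hN : N ≠ ⊤)
    {x : V} (hx : x ∈ N) : x ∈ belowSpan n v := by
  obtain ⟨c, y, hy, rfl⟩ := exists_eq_smul_add hv hE hζ hgen x
  obtain ⟨J, hJ⟩ := exists_lowerKiller hv hy
  obtain ⟨c', hc', h⟩ := lowerKiller_smul_top hv.1 J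
  by_cases hc : c = 0
  · simpa [hc] using hy
  · exfalso
    have h1 := N.smul_mem (lowerKiller d J) hx
    rw [smul_add, hJ J le_rfl, add_zero, smul_scalar, h, smul_smul] at h1
    have h2 := N.smul_mem (algebraMap Cq U (c * c')⁻¹) h1
    rw [algebraMap_smul, smul_smul, inv_mul_cancel₀ (mul_ne_zero hc hc'), one_smul] at h2
    apply hN
    rw [← top_le_iff, ← hgen, Submodule.span_singleton_le_iff_mem]
    exact h2

/-- The sum of the proper submodules of a module generated by a maximal vector is proper. -/
theorem sSup_proper_ne_top (hv : IsWt d e n v) (hv0 : v ≠ 0) (hE : B1 • v = 0) {ζ : Cq}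
    (hζ : Z • v = ζ • v) (hgen : Submodule.span U {v} = ⊤) :
    sSup {N : Submodule U V | N ≠ ⊤} ≠ ⊤ := by
  intro h
  have hmem : v ∈ ⨆ N : {N : Submodule U V | N ≠ ⊤}, N.1 := by
    rw [← sSup_eq_iSup', h]
    trivial
  refine notMem_belowSpan hv hv0 (Submodule.iSup_induction _ (motive := (· ∈ belowSpan n v)) hmem
    (fun N x hx => mem_belowSpan_of_mem hv hE hζ hgen N.2 hx) (Submodule.zero_mem _)
    (fun x y hx hy => Submodule.add_mem _ hx hy))

/-- The `Dd`-weights of a module generated by a maximal vector are bounded by its weight. -/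
theorem eigenvalue_le_of_generated (hv : IsWt d e n v) (hE : B1 • v = 0) {ζ : Cq}
    (hζ : Z • v = ζ • v) (hgen : Submodule.span U {v} = ⊤) {d' : ℤ} {x : V} (hx0 : x ≠ 0)
    (hx : Dd • x = q ^ d' • x) : d' ≤ d := by
  by_contra hlt
  obtain ⟨c, y, hy, rfl⟩ := exists_eq_smul_add hv hE hζ hgen x
  obtain ⟨J, hJ⟩ := exists_lowerKiller hv hy
  -- `lowerKiller` leaves a multiple of `v`, which the factor `Dd - q ^ d` kills. On `x` itself
  -- every factor acts by a nonzero scalar, since `d < d'`.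
  have h1 : (Dd - algebraMap Cq U (q ^ d)) • lowerKiller d J • (c • v + y) = 0 := by
    rw [smul_add _ (c • v), hJ J le_rfl, add_zero, lowerKiller_smul (c := d)
      (by rw [smul_scalar, hv.1, smul_comm]), smul_scalar, smul_scalar, sub_smul, hv.1,
      algebraMap_smul, sub_self, smul_zero, smul_zero]
  rw [lowerKiller_smul hx, smul_scalar, sub_smul, hx, algebraMap_smul, ← sub_smul, smul_smul] at h1
  refine smul_ne_zero (mul_ne_zero (Finset.prod_ne_zero_iff.mpr fun j _ => ?_) ?_) hx0 h1
  all_goals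
    rw [sub_ne_zero]
    intro h
    have := q_zpow_injective h
    push_cast at this
    omega

theorem eq_smul_of_generated (hv : IsWt d e n v) (hE : B1 • v = 0) {ζ : Cq}
    (hζ : Z • v = ζ • v) (hgen : Submodule.span U {v} = ⊤) {x : V}
    (hx : Dd • x = q ^ d • x) : ∃ c : Cq, x = c • v := by
  obtain ⟨c, y, hy, rfl⟩ := exists_eq_smul_add hv hE hζ hgen x
  obtain ⟨J, hJ⟩ := exists_lowerKiller hv hy
  have hy' : Dd • y = q ^ d • y := by
    rw [smul_add, smul_add, smul_scalar, hv.1, smul_comm c] at hx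
    exact add_left_cancel hx
  obtain ⟨c', hc', h⟩ := lowerKiller_smul_top hy' J
  rw [hJ J le_rfl] at h
  have : y = 0 := (smul_eq_zero.mp h.symm).resolve_left hc'
  exact ⟨c, by rw [this, add_zero]⟩

end

section

variable {V : Type*} [AddCommGroup V] [Module Cq V] [Module U V] [IsScalarTower Cq U V]

/-! ### Maximal vectors in rational representations -/

/-- A stable subspace is the sum of its intersections with the eigenspaces. Used for `Dd`, `D1`,
`B0` in turn, this yields a simultaneous eigenspace. -/
theorem DiagonalizableIn.exists_eigen [Module.Finite Cq V] {u : U} {S : Set Cq}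
    (h : DiagonalizableIn V u S) {p : Submodule Cq V} (hp : p ≠ ⊥) (hst : ∀ x ∈ p, u • x ∈ p) :
    ∃ c ∈ S, p ⊓ (act V u).eigenspace c ≠ ⊥ := by
  by_contra! hbot
  have htop : ⨆ c, (act V u).eigenspace c = ⊤ := by
    rw [← top_le_iff, ← h]
    exact iSup₂_le fun c _ => le_iSup (act V u).eigenspace c
  apply hp
  rw [Submodule.eq_iSup_inf_genEigenspace (f := act V u) (k := 1) hst htop, iSup_eq_bot]
  intro c
  by_cases hc : c ∈ S
  · exact hbot c hc
  -- The eigenspaces for `S` already fill the module, so an eigenvalue outside `S` has zero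
  -- eigenspace.
  · have hd : Disjoint ((act V u).eigenspace c) (⨆ c ∈ S, (act V u).eigenspace c) :=
      (act V u).eigenspaces_iSupIndep.disjoint_biSup hc
    rw [show (⨆ c ∈ S, (act V u).eigenspace c) = ⊤ from h, disjoint_top] at hd
    rw [← le_bot_iff, ← hd]
    exact inf_le_right

variable (V) in
theorem finite_Dd_weights [Module.Finite Cq V] :
    {m : ℤ | ∃ x : V, x ≠ 0 ∧ Dd • x = q ^ m • x}.Finite := by
  refine ((act V Dd).finite_hasEigenvalue.preimage q_zpow_injective.injOn).subset ?_
  rintro m ⟨x, hx0, hx⟩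
  exact Module.End.hasEigenvalue_of_hasEigenvector
    ⟨Module.End.mem_eigenspace_iff.mpr hx, hx0⟩

/-- A longer ladder would reach a `Dd`-weight below all that occur. The bound depends on `d` only,
so one `M` serves a whole subspace of vectors. -/
theorem exists_Gs_eq_zero [Module.Finite Cq V] (d : ℤ) :
    ∃ M : ℕ, ∀ (e n : ℤ) (x : V), IsWt d e n x → ∀ ε : ℤ, ε = 1 ∨ ε = -1 →
      Gs ε n M • x = 0 := by
  obtain ⟨b, hb⟩ := (finite_Dd_weights V).bddBelow
  refine ⟨(d - b + 1).toNat, fun e n x hx ε hε => ?_⟩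
  by_contra h0
  have := hb ⟨_, h0, (hx.Gs hε _).1⟩
  omega

/-- Diagonalizability of `Z` is not part of rationality. If none of the listed values were an
eigenvalue on `W`, each operator `Z + a` would be bijective on `W`, and by `B1_Gs` the vanishing of
a long plus ladder on all of `W` would descend to the ladder of length zero, giving `W = 0`. -/
theorem exists_Z_eigen [Module.Finite Cq V] {d e n : ℤ} {W : Submodule Cq V} (hW : W ≠ ⊥)
    (hwt : ∀ x ∈ W, IsWt d e n x) (hE : ∀ x ∈ W, B1 • x = 0) (hZ : ∀ x ∈ W, Z • x ∈ W) :
    ∃ m : ℕ, ∃ x ∈ W, x ≠ 0 ∧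
      Z • x = (-(q ^ (-(d - e)) * qInt n + qInt (d - e - n - 2 * m))) • x := by
  by_contra! hne
  obtain ⟨M, hM⟩ := exists_Gs_eq_zero (V := V) d
  have hstep (m : ℕ) (h : ∀ x ∈ W, Gs 1 n (m + 1) • x = 0) : ∀ x ∈ W, Gs 1 n m • x = 0 := by
    set a := q ^ (-(d - e)) * qInt n + qInt (d - e - n - 2 * m) with ha
    let S : Module.End Cq V := act V Z + a • 1
    have hS (x : V) : S x = Z • x + a • x := rfl
    have hSW : ∀ x ∈ W, S x ∈ W := fun x hx => W.add_mem (hZ x hx) (W.smul_mem _ hx)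
    have hinj : Function.Injective (S.restrict hSW) := by
      rw [← LinearMap.ker_eq_bot, LinearMap.ker_eq_bot']
      rintro ⟨x, hx⟩ hx0
      have h1 : Z • x + a • x = 0 := congrArg Subtype.val hx0
      by_contra hxne
      refine hne m x hx (fun h0 => hxne (Subtype.ext h0)) ?_
      rw [neg_smul]
      exact eq_neg_of_add_eq_zero_left h1
    have hsurj := LinearMap.surjective_of_injective hinj
    intro y hy
    obtain ⟨⟨x, hx⟩, hxy⟩ := hsurj ⟨y, hy⟩
    have h1 : Z • x + a • x = y := congrArg Subtype.val hxy
    have h2 := (hwt x hx).B1_Gs (hE x hx) (.inl rfl) m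
    rw [h x hx, smul_zero, one_mul, Int.cast_one, one_smul, ← ha, h1] at h2
    exact (smul_eq_zero.mp h2.symm).resolve_left (qInt_ne_zero (by omega))
  have hall : ∀ m ≤ M, ∀ x ∈ W, Gs 1 n (M - m) • x = 0 := by
    intro m
    induction m with
    | zero => exact fun _ x hx => hM e n x (hwt x hx) 1 (.inl rfl)
    | succ m ih =>
      intro hm
      apply hstep
      rw [show M - (m + 1) + 1 = M - m by omega]
      exact ih (by omega)
  apply hW
  rw [Submodule.eq_bot_iff]
  intro x hx
  simpa [Gs] using hall M le_rfl x hx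

theorem exists_maximal_of_isRational [Nontrivial V] (hV : IsRational V) :
    ∃ (κd κ1 n i : ℤ) (v : V), 0 ≤ i ∧ i ≤ κd - κ1 ∧ v ≠ 0 ∧ IsWt κd κ1 n v ∧ B1 • v = 0 ∧
      Z • v = domZeta κd κ1 n i • v := by
  have h0 := q_ne_zero
  have := hV.finite
  obtain ⟨_, ⟨d₀, rfl⟩, hd₀⟩ := hV.diag_Dd.exists_eigen (p := ⊤) top_ne_bot (fun _ _ => trivial)
  have hnonempty : {m : ℤ | ∃ x : V, x ≠ 0 ∧ Dd • x = q ^ m • x}.Nonempty := by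
    obtain ⟨x, hx, hx0⟩ := Submodule.exists_mem_ne_zero_of_ne_bot hd₀
    exact ⟨d₀, x, hx0, Module.End.mem_eigenspace_iff.mp hx.2⟩
  obtain ⟨d, ⟨x₀, hx₀, hx₀'⟩, hmax⟩ :=
    Set.exists_max_image _ id (finite_Dd_weights V) hnonempty
  have hW₀ : (act V Dd).eigenspace (q ^ d) ≠ ⊥ := fun h =>
    hx₀ ((Submodule.mem_bot Cq).mp (h ▸ Module.End.mem_eigenspace_iff.mpr hx₀'))
  obtain ⟨_, ⟨e, rfl⟩, hW₁⟩ := hV.diag_D1.exists_eigen hW₀ (fun x hx => by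
    rw [Module.End.mem_eigenspace_iff, act_apply] at hx ⊢
    rw [← mul_smul, Dd_mul_D1, mul_smul, hx, smul_comm])
  obtain ⟨_, ⟨n, rfl⟩, hW⟩ := hV.diag_B0.exists_eigen hW₁ (fun x hx => by
    rw [Submodule.mem_inf, Module.End.mem_eigenspace_iff, Module.End.mem_eigenspace_iff, act_apply,
      act_apply] at hx ⊢
    rw [← mul_smul, Dd_mul_B0, mul_smul, hx.1, smul_comm, ← mul_smul, D1_mul_B0, mul_smul, hx.2,
      smul_comm B0]
    exact ⟨rfl, rfl⟩)
  set W := (act V Dd).eigenspace (q ^ d) ⊓ (act V D1).eigenspace (q ^ e) ⊓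
    (act V B0).eigenspace (qInt n) with hWdef
  have hmem (x : V) : x ∈ W ↔ IsWt d e n x := by
    simp only [hWdef, Submodule.mem_inf, Module.End.mem_eigenspace_iff, act_apply]
    exact ⟨fun h => ⟨h.1.1, h.1.2, h.2⟩, fun h => ⟨⟨h.1, h.2⟩, h.3⟩⟩
  -- `B1` raises the `Dd`-weight by one, and `d` is the largest that occurs.
  have hE : ∀ x ∈ W, B1 • x = 0 := by
    intro x hx
    by_contra hne
    have h1 : Dd • B1 • x = q ^ (d + 1) • B1 • x := by
      rw [smul_smul_of_comm Dd_mul_B1, ((hmem x).mp hx).1, smul_scalar, smul_smul,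
        zpow_add_one₀ h0, mul_comm]
    have := hmax (d + 1) ⟨_, hne, h1⟩
    simp at this
  obtain ⟨m, v, hv, hv0, hZv⟩ := exists_Z_eigen hW (fun x hx => (hmem x).mp hx) hE
    (fun x hx => (hmem _).mpr ((hmem x).mp hx).Z)
  have hwt := (hmem v).mp hv
  obtain ⟨M, hM⟩ := exists_Gs_eq_zero (V := V) d
  have hex : ∃ j, Gs (-1) n j • v = 0 := ⟨M, hM e n v hwt _ (.inr rfl)⟩
  classical
  -- The shortest vanishing minus ladder has positive length because `v` is nonzero.
  obtain ⟨j, hj⟩ : ∃ j, Nat.find hex = j + 1 := Nat.exists_eq_succ_of_ne_zero fun h => by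
    have := Nat.find_spec hex
    rw [h] at this
    exact hv0 (by simpa [Gs] using this)
  have hj0 : Gs (-1) n j • v ≠ 0 := Nat.find_min hex (by omega)
  have hj1 : Gs (-1) n (j + 1) • v = 0 := hj ▸ Nat.find_spec hex
  have h1 := hwt.B1_Gs (hE v hv) (.inr rfl) j
  rw [hj1, smul_zero, hZv, smul_smul, ← add_smul, smul_scalar, smul_smul] at h1
  have h2 := (smul_eq_zero.mp h1.symm).resolve_right hj0
  have h3 := (mul_eq_zero.mp h2).resolve_left (qInt_ne_zero (by omega))
  -- Comparison of the two expressions for the `Z`-eigenvalue, from the plus and the minus ladder;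
  -- it gives `d - e = m + j`.
  have h4 : qInt (d - e - n - 2 * m) = qInt (-(d - e + n - 2 * j)) := by
    rw [show d - e - -1 * n - 2 * j = d - e + n - 2 * j by ring, neg_one_mul, qInt_neg] at h3
    rw [qInt_neg]
    push_cast at h3
    linear_combination h3
  have h5 := qInt_injective h4
  refine ⟨d, e, n, j, v, by omega, by omega, hv0, hwt, hE v hv, ?_⟩
  rw [hZv, domZeta, show n + (d - e) - 2 * (j : ℤ) = -(d - e - n - 2 * m) by omega, qInt_neg]
  congr 1
  ring

/-! ### Uniqueness of the highest weight -/

theorem domZeta_injective {κd κ1 n i i' : ℤ} (h : domZeta κd κ1 n i = domZeta κd κ1 n i') :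
    i = i' := by
  have := qInt_injective (sub_left_injective h)
  omega

/-- Both vectors generate the module, so each `Dd`-weight bounds the other. They agree, and the top
weight space is a line, so the vectors are proportional. -/
theorem highest_weight_unique [IsSimpleModule U V] {κd κ1 n i κd' κ1' n' i' : ℤ} {v v' : V}
    (hv0 : v ≠ 0) (hv : IsWt κd κ1 n v) (hE : B1 • v = 0) (hZ : Z • v = domZeta κd κ1 n i • v)
    (hv0' : v' ≠ 0) (hv' : IsWt κd' κ1' n' v') (hE' : B1 • v' = 0)
    (hZ' : Z • v' = domZeta κd' κ1' n' i' • v') :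
    κd = κd' ∧ κ1 = κ1' ∧ n = n' ∧ i = i' := by
  have hg := IsSimpleModule.span_singleton_eq_top U hv0
  have hg' := IsSimpleModule.span_singleton_eq_top U hv0'
  have hd : κd = κd' := le_antisymm (eigenvalue_le_of_generated hv' hE' hZ' hg' hv0 hv.1)
    (eigenvalue_le_of_generated hv hE hZ hg hv0' hv'.1)
  subst hd
  obtain ⟨c, rfl⟩ := eq_smul_of_generated hv hE hZ hg hv'.1
  have key {u : U} {a b : Cq} (ha : u • v = a • v) (hb : u • c • v = b • c • v) : a = b := by
    rw [smul_scalar, ha, smul_comm] at hb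
    exact smul_left_injective Cq hv0' hb
  have h1 : κ1 = κ1' := q_zpow_injective (key hv.2 hv'.2)
  have h2 : n = n' := qInt_injective (key hv.3 hv'.3)
  subst h1 h2
  exact ⟨rfl, rfl, rfl, domZeta_injective (key hZ hZ')⟩

theorem IsWt.map {V' : Type*} [AddCommGroup V'] [Module Cq V'] [Module U V'] [IsScalarTower Cq U V']
    (f : V →ₗ[U] V') {d e n : ℤ} {v : V} (hv : IsWt d e n v) : IsWt d e n (f v) where
  Dd_smul := by rw [← map_smul, hv.1, LinearMap.map_smul_of_tower]
  D1_smul := by rw [← map_smul, hv.2, LinearMap.map_smul_of_tower]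
  B0_smul := by rw [← map_smul, hv.3, LinearMap.map_smul_of_tower]

end

/-! ### Verma modules and their irreducible quotients -/

section

variable (κd κ1 : ℤ) (β ζ : Cq)

/-- The generator of the Verma module. -/
def vermaGen : Verma κd κ1 β ζ := (vermaIdeal κd κ1 β ζ).mkQ 1

variable {κd κ1 β ζ}

theorem smul_vermaGen (u : U) : u • vermaGen κd κ1 β ζ = (vermaIdeal κd κ1 β ζ).mkQ u := by
  rw [vermaGen, ← map_smul, smul_eq_mul, mul_one]

theorem smul_vermaGen_eq {u : U} {c : Cq} (h : u - algebraMap Cq U c ∈ vermaIdeal κd κ1 β ζ) :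
    u • vermaGen κd κ1 β ζ = c • vermaGen κd κ1 β ζ := by
  have hc : c • vermaGen κd κ1 β ζ = algebraMap Cq U c • vermaGen κd κ1 β ζ := by
    rw [smul_vermaGen, Algebra.algebraMap_eq_smul_one]
    rfl
  rw [hc, smul_vermaGen, smul_vermaGen, ← sub_eq_zero, ← map_sub]
  exact (Submodule.Quotient.mk_eq_zero _).mpr h

theorem span_vermaGen : Submodule.span U {vermaGen κd κ1 β ζ} = ⊤ := by
  rw [← top_le_iff]
  intro x _
  obtain ⟨u, rfl⟩ := (vermaIdeal κd κ1 β ζ).mkQ_surjective x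
  exact Submodule.mem_span_singleton.mpr ⟨u, smul_vermaGen u⟩

theorem B1_smul_vermaGen : B1 • vermaGen κd κ1 β ζ = 0 := by
  rw [smul_vermaGen]
  exact (Submodule.Quotient.mk_eq_zero _).mpr (Submodule.subset_span (by simp))

theorem Z_smul_vermaGen : Z • vermaGen κd κ1 β ζ = ζ • vermaGen κd κ1 β ζ :=
  smul_vermaGen_eq (Submodule.subset_span (by simp))

theorem isWt_vermaGen {n : ℤ} : IsWt κd κ1 n (vermaGen κd κ1 (qInt n) ζ) where
  Dd_smul := smul_vermaGen_eq (Submodule.subset_span (by simp))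
  D1_smul := smul_vermaGen_eq (Submodule.subset_span (by simp))
  B0_smul := smul_vermaGen_eq (Submodule.subset_span (by simp))

variable {V : Type*} [AddCommGroup V] [Module Cq V] [Module U V] [IsScalarTower Cq U V]

/-- The universal property of the Verma module. -/
theorem exists_verma_hom {n : ℤ} {v : V} (hv : IsWt κd κ1 n v) (hE : B1 • v = 0)
    (hZ : Z • v = ζ • v) :
    ∃ f : Verma κd κ1 (qInt n) ζ →ₗ[U] V, f (vermaGen κd κ1 (qInt n) ζ) = v := by
  have hle : vermaIdeal κd κ1 (qInt n) ζ ≤ LinearMap.ker (LinearMap.toSpanSingleton U V v) := by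
    rw [vermaIdeal, Submodule.span_le]
    have key {u : U} {c : Cq} (h : u • v = c • v) :
        u - algebraMap Cq U c ∈ LinearMap.ker (LinearMap.toSpanSingleton U V v) := by
      rw [LinearMap.mem_ker, LinearMap.toSpanSingleton_apply, sub_smul, algebraMap_smul, h,
        sub_self]
    rintro _ (rfl | rfl | rfl | rfl | rfl | rfl)
    · simpa using hE
    -- `X` kills `v` automatically, since `B1` does and `v` is an eigenvector of `B0`.
    · simp only [SetLike.mem_coe, LinearMap.mem_ker, LinearMap.toSpanSingleton_apply, X, qComm]
      rw [sub_smul, smul_assoc, mul_smul, mul_smul, hE, hv.3, smul_scalar, hE]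
      simp
    · exact key hv.1
    · exact key hv.2
    · exact key hv.3
    · exact key hZ
  refine ⟨Submodule.liftQ _ _ hle, ?_⟩
  rw [vermaGen, Submodule.mkQ_apply, Submodule.liftQ_apply, LinearMap.toSpanSingleton_apply,
    one_smul]

theorem vermaRadical_ne_top {n : ℤ} (h : vermaGen κd κ1 (qInt n) ζ ≠ 0) :
    vermaRadical κd κ1 (qInt n) ζ ≠ ⊤ :=
  sSup_proper_ne_top isWt_vermaGen h B1_smul_vermaGen Z_smul_vermaGen span_vermaGen

theorem le_vermaRadical {N : Submodule U (Verma κd κ1 β ζ)} (hN : N ≠ ⊤) :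
    N ≤ vermaRadical κd κ1 β ζ := le_sSup hN

theorem isSimpleModule_L {n : ℤ} (h : vermaGen κd κ1 (qInt n) ζ ≠ 0) :
    IsSimpleModule U (L κd κ1 (qInt n) ζ) := by
  rw [isSimpleModule_iff_isCoatom]
  exact ⟨vermaRadical_ne_top h, fun N hN => by
    by_contra hne
    exact hN.not_ge (le_vermaRadical hne)⟩

/-- The kernel of the map from the Verma module is a maximal submodule inside the radical; as the
radical is proper, the two coincide. -/
theorem nonempty_equiv_L [IsSimpleModule U V] {n : ℤ} {v : V} (hv0 : v ≠ 0) (hv : IsWt κd κ1 n v)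
    (hE : B1 • v = 0) (hZ : Z • v = ζ • v) : Nonempty (V ≃ₗ[U] L κd κ1 (qInt n) ζ) := by
  obtain ⟨f, hf⟩ := exists_verma_hom hv hE hZ
  have hgen0 : vermaGen κd κ1 (qInt n) ζ ≠ 0 := fun h => hv0 (by rw [← hf, h, map_zero])
  have hsurj : Function.Surjective f := by
    rw [← LinearMap.range_eq_top, ← top_le_iff, ← IsSimpleModule.span_singleton_eq_top U hv0,
      Submodule.span_singleton_le_iff_mem]
    exact ⟨_, hf⟩
  have hsimple : IsSimpleModule U (Verma κd κ1 (qInt n) ζ ⧸ LinearMap.ker f) :=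
    IsSimpleModule.congr (f.quotKerEquivOfSurjective hsurj)
  rw [isSimpleModule_iff_isCoatom] at hsimple
  have heq : LinearMap.ker f = vermaRadical κd κ1 (qInt n) ζ := by
    by_contra hne
    exact vermaRadical_ne_top hgen0 (hsimple.2 _ (lt_of_le_of_ne (le_vermaRadical hsimple.1) hne))
  exact ⟨(f.quotKerEquivOfSurjective hsurj).symm.trans (Submodule.quotEquivOfEq _ _ heq)⟩

/-- The image of the generator in the irreducible quotient is a maximal vector. -/
theorem exists_maximal_L {n : ℤ} (h : vermaGen κd κ1 (qInt n) ζ ≠ 0) :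
    ∃ v : L κd κ1 (qInt n) ζ, v ≠ 0 ∧ IsWt κd κ1 n v ∧ B1 • v = 0 ∧ Z • v = ζ • v := by
  set π := (vermaRadical κd κ1 (qInt n) ζ).mkQ
  refine ⟨π (vermaGen κd κ1 (qInt n) ζ), fun h0 => ?_, isWt_vermaGen.map π, ?_, ?_⟩
  · apply vermaRadical_ne_top h
    rw [← top_le_iff, ← span_vermaGen, Submodule.span_singleton_le_iff_mem]
    exact (Submodule.Quotient.mk_eq_zero _).mp h0
  · rw [← map_smul, B1_smul_vermaGen, map_zero]
  · rw [← map_smul, Z_smul_vermaGen, LinearMap.map_smul_of_tower]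

/-- If the vector `v` of a module lies in a finite dimensional submodule, then the irreducible
quotient of the Verma module mapping onto the submodule generated by `v` is finite dimensional. -/
theorem finite_L {n : ℤ} {v : V} (hv0 : v ≠ 0) (hv : IsWt κd κ1 n v)
    (hE : B1 • v = 0) (hZ : Z • v = ζ • v) (T : Submodule Cq V) [Module.Finite Cq T]
    (hT : ∀ u : U, ∀ x ∈ T, u • x ∈ T) (hvT : v ∈ T) :
    vermaGen κd κ1 (qInt n) ζ ≠ 0 ∧ Module.Finite Cq (L κd κ1 (qInt n) ζ) := by
  obtain ⟨f, hf⟩ := exists_verma_hom hv hE hZ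
  have hgen0 : vermaGen κd κ1 (qInt n) ζ ≠ 0 := fun h => hv0 (by rw [← hf, h, map_zero])
  refine ⟨hgen0, ?_⟩
  -- The kernel is proper, hence inside the radical: the irreducible quotient is a quotient of the
  -- image of `f`, whether or not that image is simple.
  have hker : LinearMap.ker f ≤ vermaRadical κd κ1 (qInt n) ζ := by
    refine le_vermaRadical fun h => hv0 ?_
    rw [← hf]
    exact LinearMap.mem_ker.mp (h ▸ trivial)
  have hrange : ∀ x, f x ∈ T := by
    intro x
    obtain ⟨u, rfl⟩ := Submodule.mem_span_singleton.mp
      (show x ∈ Submodule.span U {vermaGen κd κ1 (qInt n) ζ} by rw [span_vermaGen]; trivial)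
    rw [map_smul, hf]
    exact hT u v hvT
  let g : Verma κd κ1 (qInt n) ζ →ₗ[Cq] T := (f.restrictScalars Cq).codRestrict T hrange
  have h1 : Module.Finite Cq (Verma κd κ1 (qInt n) ζ ⧸ LinearMap.ker g) :=
    Module.Finite.equiv g.quotKerEquivRange.symm
  let π := (vermaRadical κd κ1 (qInt n) ζ).mkQ.restrictScalars Cq
  have hle : LinearMap.ker g ≤ LinearMap.ker π := by
    intro x hx
    have hx' : f x = 0 := congrArg Subtype.val (LinearMap.mem_ker.mp hx)
    exact LinearMap.mem_ker.mpr ((Submodule.Quotient.mk_eq_zero _).mpr (hker hx'))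
  refine Module.Finite.of_surjective ((LinearMap.ker g).liftQ π hle) fun y => ?_
  obtain ⟨x, rfl⟩ := (vermaRadical κd κ1 (qInt n) ζ).mkQ_surjective y
  exact ⟨Submodule.Quotient.mk x, rfl⟩

end

/-! ### An explicit module -/

/-- The vector space underlying the explicit module of highest weight
`(d, d - r - s, [n], [n + r - s] - q ^ (-(r + s)) [n])`. -/
abbrev LatticeSpace : Type := (ℤ × ℤ) →₀ Cq

/-- The basis vectors. -/
def bv (a b : ℤ) : LatticeSpace := Finsupp.single (a, b) 1

/-- The `B0`-level of a basis vector. -/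
def lvl (n a b : ℤ) : ℤ := n + a - b

/-- A diagonal operator. -/
def opDiag (c : ℤ → ℤ → Cq) : Module.End Cq LatticeSpace :=
  Finsupp.linearCombination Cq fun p => c p.1 p.2 • bv p.1 p.2

/-- The operator by which `Bm1` acts. -/
def opF (n r s : ℤ) : Module.End Cq LatticeSpace :=
  Finsupp.linearCombination Cq fun p =>
    (qInt (r - p.1) * (qCosh (lvl n p.1 p.2))⁻¹) • bv (p.1 + 1) p.2 +
    (qInt (s - p.2) * (qCosh (lvl n p.1 p.2))⁻¹) • bv p.1 (p.2 + 1)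

/-- The operator by which `B1` acts. -/
def opE (n r s : ℤ) : Module.End Cq LatticeSpace :=
  Finsupp.linearCombination Cq fun p =>
    (qInt p.1 * qCosh (lvl n p.1 p.2 + p.2 - s - 1) * qCosh (lvl n p.1 p.2 + p.2) *
      (qCosh (lvl n p.1 p.2))⁻¹) • bv (p.1 - 1) p.2 +
    (qInt p.2 * qCosh (lvl n p.1 p.2 - p.1 + r + 1) * qCosh (lvl n p.1 p.2 - p.1) *
      (qCosh (lvl n p.1 p.2))⁻¹) • bv p.1 (p.2 - 1)

/-- The action of the generators. -/
def opGen (d n r s : ℤ) : Gen → Module.End Cq LatticeSpace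
  | .B0 => opDiag fun a b => qInt (lvl n a b)
  | .B1 => opE n r s
  | .Bm1 => opF n r s
  | .Dd => opDiag fun a b => q ^ (d - a - b)
  | .DdInv => opDiag fun a b => q ^ (-(d - a - b))
  | .D1 => opDiag fun a b => q ^ (d - r - s + a + b)
  | .D1Inv => opDiag fun a b => q ^ (-(d - r - s + a + b))

variable {d n r s : ℤ}

theorem lvl_fst_add (a b : ℤ) : lvl n (a + 1) b = lvl n a b + 1 := by unfold lvl; ring
theorem lvl_fst_sub (a b : ℤ) : lvl n (a - 1) b = lvl n a b - 1 := by unfold lvl; ring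
theorem lvl_snd_add (a b : ℤ) : lvl n a (b + 1) = lvl n a b - 1 := by unfold lvl; ring
theorem lvl_snd_sub (a b : ℤ) : lvl n a (b - 1) = lvl n a b + 1 := by unfold lvl; ring

theorem opDiag_bv (c : ℤ → ℤ → Cq) (a b : ℤ) : opDiag c (bv a b) = c a b • bv a b := by
  simp [opDiag, bv, Finsupp.linearCombination_single]

/-- The basis is normalized so that the two ladder steps have coefficients `[r - a]` and `[s - b]`;
the division by `qCosh` is the one in `Bm1_smul_eq`. -/
theorem opF_bv (a b : ℤ) : opF n r s (bv a b) =
    (qInt (r - a) * (qCosh (lvl n a b))⁻¹) • bv (a + 1) b +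
    (qInt (s - b) * (qCosh (lvl n a b))⁻¹) • bv a (b + 1) := by
  simp only [opF, bv, Finsupp.linearCombination_single, one_smul]

/-- On the edge `b = 0` the coefficient is dictated by `IsWt.B1_Gs`: there `[n + r - s] + [r + s - n
- 2 (a - 1)]` equals `[r - a + 1]` times `qCosh (n + a - s - 1)`, and the first factor is absorbed
by the normalization of the basis. -/
theorem opE_bv (a b : ℤ) : opE n r s (bv a b) =
    (qInt a * qCosh (lvl n a b + b - s - 1) * qCosh (lvl n a b + b) *
      (qCosh (lvl n a b))⁻¹) • bv (a - 1) b +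
    (qInt b * qCosh (lvl n a b - a + r + 1) * qCosh (lvl n a b - a) *
      (qCosh (lvl n a b))⁻¹) • bv a (b - 1) := by
  simp only [opE, bv, Finsupp.linearCombination_single, one_smul]

/-! ### Verification of the defining relations on the lattice -/

theorem lattice_ext {f g : Module.End Cq LatticeSpace} (h : ∀ a b, f (bv a b) = g (bv a b)) :
    f = g := by
  apply Finsupp.lhom_ext'
  rintro ⟨a, b⟩
  apply LinearMap.ext_ring
  exact h a b

/-- Inverses get polynomial denominators in `q ^ c`, known to be nonzero; the relations become
identities of rational functions in independent variables. -/
theorem inv_qCosh (c : ℤ) : (qCosh c)⁻¹ = q ^ c * ((q ^ c) ^ 2 + 1)⁻¹ := by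
  have h := zpow_ne_zero c q_ne_zero
  rw [qCosh, zpow_neg]
  rw [show q ^ c + (q ^ c)⁻¹ = ((q ^ c) ^ 2 + 1) * (q ^ c)⁻¹ by field_simp, mul_inv, inv_inv,
    mul_comm]

theorem q_zpow_sq_add_one_ne_zero (c : ℤ) : (q ^ c) ^ 2 + 1 ≠ 0 := by
  intro h
  apply q_zpow_ne_neg_one (c + c)
  rw [zpow_add₀ q_ne_zero]
  linear_combination h

theorem sq_mul_q_sq_add_one_ne_zero (c : ℤ) : (q ^ c) ^ 2 * q ^ 2 + 1 ≠ 0 := by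
  have := q_zpow_sq_add_one_ne_zero (c + 1)
  rwa [zpow_add_one₀ q_ne_zero, mul_pow] at this

theorem sq_add_q_sq_ne_zero (c : ℤ) : (q ^ c) ^ 2 + q ^ 2 ≠ 0 := by
  have h := q_zpow_sq_add_one_ne_zero (c - 1)
  have h0 := q_ne_zero
  intro h1
  apply h
  rw [zpow_sub_one₀ h0]
  field_simp
  linear_combination h1

theorem inv_qCosh_add_one (c : ℤ) :
    (qCosh (c + 1))⁻¹ = q ^ c * q * (q ^ 2 * (q ^ c) ^ 2 + 1)⁻¹ := by
  rw [inv_qCosh, zpow_add_one₀ q_ne_zero]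
  ring

theorem inv_qCosh_sub_one (c : ℤ) :
    (qCosh (c - 1))⁻¹ = q ^ c * q * ((q ^ c) ^ 2 + q ^ 2)⁻¹ := by
  have h0 := q_ne_zero
  have h1 := sq_add_q_sq_ne_zero c
  rw [inv_qCosh, zpow_sub_one₀ q_ne_zero,
    show (q ^ c * q⁻¹) ^ 2 + 1 = ((q ^ c) ^ 2 + q ^ 2) * (q ^ 2)⁻¹ by field_simp, mul_inv, inv_inv]
  field_simp

/-- Only the shift of the level by one matters: it amounts to `[c] ^ 2 - [2] [c] [c ± 1] + [c ± 1] ^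
2 = 1`. -/
theorem op_serre_B0_E : opGen d n r s .B0 ^ 2 * opGen d n r s .B1 -
    qInt 2 • (opGen d n r s .B0 * opGen d n r s .B1 * opGen d n r s .B0) +
    opGen d n r s .B1 * opGen d n r s .B0 ^ 2 = opGen d n r s .B1 := by
  have h0 := q_ne_zero
  have h1 := q_sq_sub_one_ne_zero
  refine lattice_ext fun a b => ?_
  simp only [opGen, pow_two, Module.End.mul_apply, LinearMap.add_apply, LinearMap.sub_apply,
    LinearMap.smul_apply, opE_bv, opDiag_bv, map_add, map_smul, smul_add, lvl_fst_sub, lvl_snd_sub,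
    qInt_two]
  generalize (qCosh _)⁻¹ = y
  generalize lvl n a b = c
  match_scalars <;>
    simp only [qInt, neg_add, zpow_neg, zpow_sub₀ h0, zpow_add₀ h0, zpow_one] <;>
    field_simp <;> ring

theorem op_serre_B0_F : opGen d n r s .B0 ^ 2 * opGen d n r s .Bm1 -
    qInt 2 • (opGen d n r s .B0 * opGen d n r s .Bm1 * opGen d n r s .B0) +
    opGen d n r s .Bm1 * opGen d n r s .B0 ^ 2 = opGen d n r s .Bm1 := by
  have h0 := q_ne_zero
  have h1 := q_sq_sub_one_ne_zero
  refine lattice_ext fun a b => ?_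
  simp only [opGen, pow_two, Module.End.mul_apply, LinearMap.add_apply, LinearMap.sub_apply,
    LinearMap.smul_apply, opF_bv, opDiag_bv, map_add, map_smul, smul_add, lvl_fst_add, lvl_snd_add,
    qInt_two]
  generalize (qCosh _)⁻¹ = y
  generalize lvl n a b = c
  match_scalars <;>
    simp only [qInt, neg_add, zpow_neg, zpow_sub₀ h0, zpow_add₀ h0, zpow_one] <;>
    field_simp <;> ring

theorem op_serre_F_B0 : opGen d n r s .Bm1 ^ 2 * opGen d n r s .B0 -
    qInt 2 • (opGen d n r s .Bm1 * opGen d n r s .B0 * opGen d n r s .Bm1) +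
    opGen d n r s .B0 * opGen d n r s .Bm1 ^ 2 = 0 := by
  have h0 := q_ne_zero
  have h1 := q_sq_sub_one_ne_zero
  refine lattice_ext fun a b => ?_
  simp only [opGen, pow_two, Module.End.mul_apply, LinearMap.add_apply, LinearMap.sub_apply,
    LinearMap.smul_apply, opF_bv, opDiag_bv, map_add, map_smul, smul_add, lvl_fst_add, lvl_snd_add,
    qInt_two, LinearMap.zero_apply, add_sub_cancel_right]
  generalize lvl n a b = c
  simp only [inv_qCosh_add_one, inv_qCosh_sub_one]
  simp only [inv_qCosh]
  have h2 := q_zpow_sq_add_one_ne_zero c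
  have h3 := sq_mul_q_sq_add_one_ne_zero c
  have h4 := sq_add_q_sq_ne_zero c
  have hx := zpow_ne_zero c h0
  have ha := zpow_ne_zero a h0
  have hb := zpow_ne_zero b h0
  have hr := zpow_ne_zero r h0
  have hs := zpow_ne_zero s h0
  match_scalars <;>
    simp only [qInt, neg_add, zpow_neg, zpow_sub₀ h0, zpow_add₀ h0, zpow_one] <;>
    generalize q ^ c = x at * <;> generalize q ^ a = α at * <;> generalize q ^ b = δ at * <;>
    generalize q ^ r = ρ at * <;> generalize q ^ s = σ at * <;>
    field_simp <;> ring

set_option maxRecDepth 4000 in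
theorem op_serre_E_B0 : opGen d n r s .B1 ^ 2 * opGen d n r s .B0 -
    qInt 2 • (opGen d n r s .B1 * opGen d n r s .B0 * opGen d n r s .B1) +
    opGen d n r s .B0 * opGen d n r s .B1 ^ 2 = 0 := by
  have h0 := q_ne_zero
  have h1 := q_sq_sub_one_ne_zero
  refine lattice_ext fun a b => ?_
  simp only [opGen, pow_two, Module.End.mul_apply, LinearMap.add_apply, LinearMap.sub_apply,
    LinearMap.smul_apply, opE_bv, opDiag_bv, map_add, map_smul, smul_add, lvl_fst_sub, lvl_snd_sub,
    qInt_two, LinearMap.zero_apply, sub_add_cancel]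
  generalize lvl n a b = c
  simp only [inv_qCosh_add_one, inv_qCosh_sub_one]
  simp only [inv_qCosh]
  have h2 := q_zpow_sq_add_one_ne_zero c
  have h3 := sq_mul_q_sq_add_one_ne_zero c
  have h4 := sq_add_q_sq_ne_zero c
  have hx := zpow_ne_zero c h0
  have ha := zpow_ne_zero a h0
  have hb := zpow_ne_zero b h0
  have hr := zpow_ne_zero r h0
  have hs := zpow_ne_zero s h0
  match_scalars <;>
    simp only [qInt, qCosh, neg_add, zpow_neg, zpow_sub₀ h0, zpow_add₀ h0, zpow_one] <;>
    generalize q ^ c = x at * <;> generalize q ^ a = α at * <;> generalize q ^ b = δ at * <;>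
    generalize q ^ r = ρ at * <;> generalize q ^ s = σ at * <;>
    field_simp <;> ring

theorem op_E_F : opGen d n r s .B1 * opGen d n r s .Bm1 - opGen d n r s .Bm1 * opGen d n r s .B1 =
    (q - q⁻¹)⁻¹ • (opGen d n r s .Dd * opGen d n r s .D1Inv -
      opGen d n r s .D1 * opGen d n r s .DdInv) := by
  have h0 := q_ne_zero
  have h1 := q_sq_sub_one_ne_zero
  refine lattice_ext fun a b => ?_
  simp only [opGen, Module.End.mul_apply, LinearMap.sub_apply,
    LinearMap.smul_apply, opE_bv, opF_bv, opDiag_bv, map_add, map_smul, smul_add, lvl_fst_sub,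
    lvl_snd_sub, lvl_fst_add, lvl_snd_add, add_sub_cancel_right, sub_add_cancel]
  generalize lvl n a b = c
  simp only [inv_qCosh_add_one, inv_qCosh_sub_one]
  simp only [inv_qCosh]
  have h2 := q_zpow_sq_add_one_ne_zero c
  have h3 := sq_mul_q_sq_add_one_ne_zero c
  have h3' := mul_comm ((q ^ c) ^ 2) (q ^ 2) ▸ h3
  have h4 := sq_add_q_sq_ne_zero c
  have hx := zpow_ne_zero c h0
  have ha := zpow_ne_zero a h0
  have hb := zpow_ne_zero b h0
  have hr := zpow_ne_zero r h0
  have hs := zpow_ne_zero s h0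
  match_scalars <;>
    simp only [qInt, qCosh, neg_add, zpow_neg, zpow_sub₀ h0, zpow_add₀ h0, zpow_one] <;>
    generalize q ^ c = x at * <;> generalize q ^ a = α at * <;> generalize q ^ b = δ at * <;>
    generalize q ^ r = ρ at * <;> generalize q ^ s = σ at * <;>
    field_simp <;> ring

theorem opGen_B0 : opGen d n r s .B0 = opDiag fun a b => qInt (lvl n a b) := by
  simp only [opGen]
theorem opGen_Dd : opGen d n r s .Dd = opDiag fun a b => q ^ (d - a - b) := by
  simp only [opGen]
theorem opGen_DdInv : opGen d n r s .DdInv = opDiag fun a b => q ^ (-(d - a - b)) := by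
  simp only [opGen]
theorem opGen_D1 : opGen d n r s .D1 = opDiag fun a b => q ^ (d - r - s + a + b) := by
  simp only [opGen]
theorem opGen_D1Inv : opGen d n r s .D1Inv = opDiag fun a b => q ^ (-(d - r - s + a + b)) := by
  simp only [opGen]
theorem opGen_B1 : opGen d n r s .B1 = opE n r s := by simp only [opGen]
theorem opGen_Bm1 : opGen d n r s .Bm1 = opF n r s := by simp only [opGen]

theorem opGen_rel {x y : Free} (h : Rel x y) :
    FreeAlgebra.lift Cq (opGen d n r s) x = FreeAlgebra.lift Cq (opGen d n r s) y := by
  have h0 := q_ne_zero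
  have hdiag {f g : ℤ → ℤ → Cq} (hfg : ∀ a b, f a b * g a b = 1) : opDiag f * opDiag g = 1 :=
    lattice_ext fun a b => by
      simp only [Module.End.mul_apply, opDiag_bv, map_smul, smul_smul, Module.End.one_apply]
      rw [mul_comm, hfg, one_smul]
  have hcomm (f g : ℤ → ℤ → Cq) : opDiag f * opDiag g = opDiag g * opDiag f :=
    lattice_ext fun a b => by
      simp only [Module.End.mul_apply, opDiag_bv, map_smul, smul_smul, mul_comm]
  have hE {f : ℤ → ℤ → Cq} {c : Cq} (h1 : ∀ a b, f (a - 1) b = c * f a b)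
      (h2 : ∀ a b, f a (b - 1) = c * f a b) :
      opDiag f * opE n r s = c • (opE n r s * opDiag f) :=
    lattice_ext fun a b => by
      simp only [Module.End.mul_apply, opDiag_bv, opE_bv, map_add, map_smul, h1, h2,
        LinearMap.smul_apply]
      module
  have hF {f : ℤ → ℤ → Cq} {c : Cq} (h1 : ∀ a b, f (a + 1) b = c * f a b)
      (h2 : ∀ a b, f a (b + 1) = c * f a b) :
      opDiag f * opF n r s = c • (opF n r s * opDiag f) :=
    lattice_ext fun a b => by
      simp only [Module.End.mul_apply, opDiag_bv, opF_bv, map_add, map_smul, h1, h2,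
        LinearMap.smul_apply]
      module
  cases h <;> simp only [gen, map_mul, map_sub, map_add, map_smul, map_pow, map_one, map_zero,
    FreeAlgebra.lift_ι_apply]
  case Dd_mul_inv =>
    rw [opGen_Dd, opGen_DdInv]
    exact hdiag fun a b => by rw [← zpow_add₀ h0, add_neg_cancel, zpow_zero]
  case Dd_inv_mul =>
    rw [opGen_Dd, opGen_DdInv]
    exact hdiag fun a b => by rw [← zpow_add₀ h0, neg_add_cancel, zpow_zero]
  case D1_mul_inv =>
    rw [opGen_D1, opGen_D1Inv]
    exact hdiag fun a b => by rw [← zpow_add₀ h0, add_neg_cancel, zpow_zero]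
  case D1_inv_mul =>
    rw [opGen_D1, opGen_D1Inv]
    exact hdiag fun a b => by rw [← zpow_add₀ h0, neg_add_cancel, zpow_zero]
  case Dd_D1 =>
    rw [opGen_Dd, opGen_D1]
    exact hcomm _ _
  case B0_Dd =>
    rw [opGen_Dd, opGen_B0]
    exact hcomm _ _
  case B0_D1 =>
    rw [opGen_D1, opGen_B0]
    exact hcomm _ _
  case Dd_B1 =>
    rw [opGen_Dd, opGen_B1]
    refine hE (fun a b => ?_) (fun a b => ?_) <;> rw [← zpow_one_add₀ h0] <;> ring_nf
  case Dd_Bm1 =>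
    rw [opGen_Dd, opGen_Bm1]
    refine hF (fun a b => ?_) (fun a b => ?_) <;>
      rw [← zpow_neg_one, ← zpow_add₀ h0] <;> ring_nf
  case D1_B1 =>
    rw [opGen_D1, opGen_B1]
    refine hE (fun a b => ?_) (fun a b => ?_) <;>
      rw [← zpow_neg_one, ← zpow_add₀ h0] <;> ring_nf
  case D1_Bm1 =>
    rw [opGen_D1, opGen_Bm1]
    refine hF (fun a b => ?_) (fun a b => ?_) <;> rw [← zpow_one_add₀ h0] <;> ring_nf
  case B1_Bm1 => exact op_E_F
  case serre_B0_B1 => exact op_serre_B0_E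
  case serre_B0_Bm1 => exact op_serre_B0_F
  case serre_B1_B0 => exact op_serre_E_B0
  case serre_Bm1_B0 => exact op_serre_F_B0

/-- The representation on the lattice space. -/
def latticeRep (d n r s : ℤ) : U →ₐ[Cq] Module.End Cq LatticeSpace :=
  RingQuot.liftAlgHom Cq ⟨FreeAlgebra.lift Cq (opGen d n r s), fun _ _ h => opGen_rel h⟩

/-- The lattice space as a representation. -/
def Lattice (_d _n _r _s : ℤ) : Type := LatticeSpace

instance : AddCommGroup (Lattice d n r s) := inferInstanceAs (AddCommGroup LatticeSpace)

instance : Module Cq (Lattice d n r s) := inferInstanceAs (Module Cq LatticeSpace)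

instance : Module (Module.End Cq LatticeSpace) (Lattice d n r s) :=
  inferInstanceAs (Module (Module.End Cq LatticeSpace) LatticeSpace)

instance : Module U (Lattice d n r s) :=
  Module.compHom _ (latticeRep d n r s).toRingHom

theorem lattice_smul (u : U) (x : Lattice d n r s) : u • x = latticeRep d n r s u x := rfl

instance : IsScalarTower Cq U (Lattice d n r s) where
  smul_assoc c u x := by rw [lattice_smul, map_smul]; rfl

theorem cls_smul (g : Gen) (x : Lattice d n r s) : cls g • x = opGen d n r s g x := by
  rw [lattice_smul, latticeRep, cls, RingQuot.liftAlgHom_mkAlgHom_apply, gen,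
    FreeAlgebra.lift_ι_apply]

/-- The basis vectors of the representation. -/
def lv (d n r s a b : ℤ) : Lattice d n r s := bv a b

theorem cls_smul_lv (g : Gen) (a b : ℤ) :
    cls g • lv d n r s a b = (opGen d n r s g (bv a b) : LatticeSpace) := cls_smul g _

theorem Bm1_smul_lv (a b : ℤ) : Bm1 • lv d n r s a b =
    (qInt (r - a) * (qCosh (lvl n a b))⁻¹) • lv d n r s (a + 1) b +
    (qInt (s - b) * (qCosh (lvl n a b))⁻¹) • lv d n r s a (b + 1) :=
  (cls_smul_lv .Bm1 a b).trans (by rw [opGen_Bm1, opF_bv]; rfl)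

theorem B1_smul_lv (a b : ℤ) : B1 • lv d n r s a b =
    (qInt a * qCosh (lvl n a b + b - s - 1) * qCosh (lvl n a b + b) *
      (qCosh (lvl n a b))⁻¹) • lv d n r s (a - 1) b +
    (qInt b * qCosh (lvl n a b - a + r + 1) * qCosh (lvl n a b - a) *
      (qCosh (lvl n a b))⁻¹) • lv d n r s a (b - 1) :=
  (cls_smul_lv .B1 a b).trans (by rw [opGen_B1, opE_bv]; rfl)

theorem B0_smul_lv (a b : ℤ) :
    B0 • lv d n r s a b = qInt (lvl n a b) • lv d n r s a b :=
  (cls_smul_lv .B0 a b).trans (by rw [opGen_B0, opDiag_bv]; rfl)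

theorem Dd_smul_lv (a b : ℤ) :
    Dd • lv d n r s a b = q ^ (d - a - b) • lv d n r s a b :=
  (cls_smul_lv .Dd a b).trans (by rw [opGen_Dd, opDiag_bv]; rfl)

theorem D1_smul_lv (a b : ℤ) :
    D1 • lv d n r s a b = q ^ (d - r - s + a + b) • lv d n r s a b :=
  (cls_smul_lv .D1 a b).trans (by rw [opGen_D1, opDiag_bv]; rfl)

theorem lv_ne_zero (a b : ℤ) : lv d n r s a b ≠ 0 :=
  Finsupp.single_ne_zero.mpr one_ne_zero

theorem isWt_lv : IsWt d (d - r - s) n (lv d n r s 0 0) where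
  Dd_smul := by simpa using Dd_smul_lv (d := d) (n := n) (r := r) (s := s) 0 0
  D1_smul := by simpa using D1_smul_lv (d := d) (n := n) (r := r) (s := s) 0 0
  B0_smul := by simpa [lvl] using B0_smul_lv (d := d) (n := n) (r := r) (s := s) 0 0

theorem B1_smul_lv_zero : B1 • lv d n r s 0 0 = 0 := by
  rw [B1_smul_lv, qInt_zero]
  simp

/-- This identifies `s` with the parameter `i`, and `r` with `κ - i`. -/
theorem Z_smul_lv : Z • lv d n r s 0 0 = domZeta d (d - r - s) n s • lv d n r s 0 0 := by
  have h0 := q_ne_zero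
  have h1 := q_sq_sub_one_ne_zero
  have hY : Y • lv d n r s 0 0 =
      ((qInt (n + 1) - q⁻¹ * qInt n) * (qInt r * (qCosh n)⁻¹)) • lv d n r s 1 0 +
      ((qInt (n - 1) - q⁻¹ * qInt n) * (qInt s * (qCosh n)⁻¹)) • lv d n r s 0 1 := by
    rw [Y, qComm, sub_smul, smul_assoc, mul_smul, mul_smul, isWt_lv.3, smul_scalar, Bm1_smul_lv,
      smul_add, smul_scalar, smul_scalar, B0_smul_lv, B0_smul_lv]
    simp only [lvl, zero_add, add_zero, sub_zero]
    module
  rw [Z, qComm, sub_smul, smul_assoc, mul_smul, mul_smul, B1_smul_lv_zero, hY, smul_add,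
    smul_scalar, smul_scalar, B1_smul_lv, B1_smul_lv]
  simp only [lvl, zero_add, add_zero, sub_zero, qInt_zero, zero_mul, zero_smul, smul_zero,
    qInt_one, one_mul, sub_self, domZeta, add_sub_cancel_right, sub_add_cancel]
  rw [inv_qCosh_add_one, inv_qCosh_sub_one, inv_qCosh]
  have h2 := q_zpow_sq_add_one_ne_zero n
  have h3 := sq_mul_q_sq_add_one_ne_zero n
  have h4 := sq_add_q_sq_ne_zero n
  have hx := zpow_ne_zero n h0
  have hr := zpow_ne_zero r h0
  have hs := zpow_ne_zero s h0
  rw [show d - (d - r - s) = r + s by ring, two_mul]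
  match_scalars
  simp only [qInt, qCosh, neg_add, zpow_neg, zpow_sub₀ h0, zpow_add₀ h0, zpow_one]
  generalize q ^ n = x at *
  generalize q ^ r = ρ at *
  generalize q ^ s = σ at *
  field_simp
  ring

/-- The span of the basis vectors in the rectangle with corners `(0, 0)` and `(r, s)`. -/
def rect (d n r s : ℤ) : Submodule Cq (Lattice d n r s) :=
  Submodule.span Cq ((fun p : ℤ × ℤ => lv d n r s p.1 p.2) '' (Set.Icc 0 r ×ˢ Set.Icc 0 s))

instance : Module.Finite Cq (rect d n r s) :=
  FiniteDimensional.span_of_finite Cq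
    (((Set.finite_Icc 0 r).prod (Set.finite_Icc 0 s)).image _)

theorem smul_lv_mem_rect {a b : ℤ} {c : Cq}
    (h : c ≠ 0 → 0 ≤ a ∧ a ≤ r ∧ 0 ≤ b ∧ b ≤ s) : c • lv d n r s a b ∈ rect d n r s := by
  by_cases hc : c = 0
  · rw [hc, zero_smul]; exact Submodule.zero_mem _
  · obtain ⟨h1, h2, h3, h4⟩ := h hc
    exact Submodule.smul_mem _ _ (Submodule.subset_span ⟨(a, b), ⟨⟨h1, h2⟩, ⟨h3, h4⟩⟩, rfl⟩)

/-- The coefficients `[a]`, `[b]`, `[r - a]`, `[s - b]` vanish on the edges across which `B1` and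
`Bm1` would leave the rectangle. -/
theorem smul_mem_rect (u : U) : ∀ x ∈ rect d n r s, u • x ∈ rect d n r s := by
  refine smul_mem_of_gens _ (fun g x hx => ?_) u
  induction hx using Submodule.span_induction with
  | zero => rw [smul_zero]; exact Submodule.zero_mem _
  | add y z _ _ hy hz => rw [smul_add]; exact Submodule.add_mem _ hy hz
  | smul c y _ hy => rw [smul_scalar]; exact Submodule.smul_mem _ _ hy
  | mem y hy =>
    obtain ⟨⟨a, b⟩, ⟨⟨h1, h2⟩, ⟨h3, h4⟩⟩, rfl⟩ := hy
    simp only at h1 h2 h3 h4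
    have hdiag {f : ℤ → ℤ → Cq} (hf : opGen d n r s g = opDiag f) :
        cls g • lv d n r s a b ∈ rect d n r s := by
      rw [cls_smul_lv, hf, opDiag_bv]
      exact smul_lv_mem_rect fun _ => ⟨h1, h2, h3, h4⟩
    cases g with
    | B0 => exact hdiag opGen_B0
    | Dd => exact hdiag opGen_Dd
    | DdInv => exact hdiag opGen_DdInv
    | D1 => exact hdiag opGen_D1
    | D1Inv => exact hdiag opGen_D1Inv
    | B1 =>
      change B1 • lv d n r s a b ∈ _
      rw [B1_smul_lv]
      refine Submodule.add_mem _ (smul_lv_mem_rect fun hc => ?_) (smul_lv_mem_rect fun hc => ?_)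
      · have : a ≠ 0 := fun h => hc (by rw [h, qInt_zero]; ring)
        omega
      · have : b ≠ 0 := fun h => hc (by rw [h, qInt_zero]; ring)
        omega
    | Bm1 =>
      change Bm1 • lv d n r s a b ∈ _
      rw [Bm1_smul_lv]
      refine Submodule.add_mem _ (smul_lv_mem_rect fun hc => ?_) (smul_lv_mem_rect fun hc => ?_)
      · have : a ≠ r := fun h => hc (by rw [h, sub_self, qInt_zero]; ring)
        omega
      · have : b ≠ s := fun h => hc (by rw [h, sub_self, qInt_zero]; ring)
        omega

/-! ### The irreducible rational representations -/

theorem vermaGen_ne_zero_and_finite_L {κd κ1 n i : ℤ} (h0 : 0 ≤ i) (h1 : i ≤ κd - κ1) :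
    vermaGen κd κ1 (qInt n) (domZeta κd κ1 n i) ≠ 0 ∧
      Module.Finite Cq (L κd κ1 (qInt n) (domZeta κd κ1 n i)) := by
  have hκ : κd - (κd - κ1 - i) - i = κ1 := by ring
  have hwt : IsWt κd κ1 n (lv κd n (κd - κ1 - i) i 0 0) := by
    have := isWt_lv (d := κd) (n := n) (r := κd - κ1 - i) (s := i)
    rwa [hκ] at this
  have hZ : Z • lv κd n (κd - κ1 - i) i 0 0 =
      domZeta κd κ1 n i • lv κd n (κd - κ1 - i) i 0 0 := by
    have := Z_smul_lv (d := κd) (n := n) (r := κd - κ1 - i) (s := i)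
    rwa [hκ] at this
  refine finite_L (lv_ne_zero 0 0) hwt B1_smul_lv_zero hZ (rect κd n (κd - κ1 - i) i) smul_mem_rect
    (Submodule.subset_span ⟨(0, 0), ⟨⟨le_rfl, ?_⟩, ⟨le_rfl, h0⟩⟩, rfl⟩)
  change 0 ≤ κd - κ1 - i
  omega

theorem isSimpleModule_L_domZeta {κd κ1 n i : ℤ} (h0 : 0 ≤ i) (h1 : i ≤ κd - κ1) :
    IsSimpleModule U (L κd κ1 (qInt n) (domZeta κd κ1 n i)) :=
  isSimpleModule_L (vermaGen_ne_zero_and_finite_L h0 h1).1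

theorem isRational_L_domZeta {κd κ1 n i : ℤ} (h0 : 0 ≤ i) (h1 : i ≤ κd - κ1) :
    IsRational (L κd κ1 (qInt n) (domZeta κd κ1 n i)) := by
  obtain ⟨hgen, hfin⟩ := vermaGen_ne_zero_and_finite_L (n := n) h0 h1
  have := isSimpleModule_L hgen
  obtain ⟨v, hv0, hv, hE, hZ⟩ := exists_maximal_L hgen
  exact isRational_of_maximal hv hE hZ (IsSimpleModule.span_singleton_eq_top U hv0)

theorem exists_equiv_L {V : Type*} [AddCommGroup V] [Module Cq V] [Module U V]
    [IsScalarTower Cq U V] (hV : IsRational V) [IsSimpleModule U V] :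
    ∃ κd κ1 n i : ℤ, 0 ≤ i ∧ i ≤ κd - κ1 ∧
      Nonempty (V ≃ₗ[U] L κd κ1 (qInt n) (domZeta κd κ1 n i)) := by
  have := IsSimpleModule.nontrivial U V
  obtain ⟨κd, κ1, n, i, v, h0, h1, hv0, hv, hE, hZ⟩ := exists_maximal_of_isRational hV
  exact ⟨κd, κ1, n, i, h0, h1, nonempty_equiv_L hv0 hv hE hZ⟩

theorem isSumOfWeightLines_of_isRational {V : Type*} [AddCommGroup V] [Module Cq V] [Module U V]
    [IsScalarTower Cq U V] (hV : IsRational V) [IsSimpleModule U V] : IsSumOfWeightLines V := by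
  have := IsSimpleModule.nontrivial U V
  obtain ⟨κd, κ1, n, i, v, h0, h1, hv0, hv, hE, hZ⟩ := exists_maximal_of_isRational hV
  exact isSumOfWeightLines_of_maximal hv hE hZ (IsSimpleModule.span_singleton_eq_top U hv0)

/-- The module `V` has a maximal vector with the given parameters of a dominant highest weight. -/
def HasHighestWeight (V : Type*) [AddCommGroup V] [Module Cq V] [Module U V]
    (κd κ1 n i : ℤ) : Prop :=
  0 ≤ i ∧ i ≤ κd - κ1 ∧
    ∃ v : V, v ≠ 0 ∧ IsWt κd κ1 n v ∧ B1 • v = 0 ∧ Z • v = domZeta κd κ1 n i • v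

section

variable {V V' : Type*} [AddCommGroup V] [Module Cq V] [Module U V] [IsScalarTower Cq U V]
  [AddCommGroup V'] [Module Cq V'] [Module U V'] [IsScalarTower Cq U V'] {κd κ1 n i : ℤ}

theorem HasHighestWeight.of_equiv (h : HasHighestWeight V κd κ1 n i) (f : V ≃ₗ[U] V') :
    HasHighestWeight V' κd κ1 n i := by
  obtain ⟨h0, h1, v, hv0, hv, hE, hZ⟩ := h
  refine ⟨h0, h1, f v, by simpa using hv0, hv.map f.toLinearMap, ?_, ?_⟩
  · rw [← map_smul, hE, map_zero]
  · rw [← map_smul, hZ]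
    exact LinearMap.map_smul_of_tower f.toLinearMap _ _

theorem HasHighestWeight.equiv_L [IsSimpleModule U V] (h : HasHighestWeight V κd κ1 n i) :
    Nonempty (V ≃ₗ[U] L κd κ1 (qInt n) (domZeta κd κ1 n i)) := by
  obtain ⟨-, -, v, hv0, hv, hE, hZ⟩ := h
  exact nonempty_equiv_L hv0 hv hE hZ

theorem hasHighestWeight_L (h0 : 0 ≤ i) (h1 : i ≤ κd - κ1) :
    HasHighestWeight (L κd κ1 (qInt n) (domZeta κd κ1 n i)) κd κ1 n i :=
  ⟨h0, h1, exists_maximal_L (vermaGen_ne_zero_and_finite_L h0 h1).1⟩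

theorem HasHighestWeight.unique [IsSimpleModule U V] {κd' κ1' n' i' : ℤ}
    (h : HasHighestWeight V κd κ1 n i) (h' : HasHighestWeight V κd' κ1' n' i') :
    κd = κd' ∧ κ1 = κ1' ∧ n = n' ∧ i = i' := by
  obtain ⟨-, -, v, hv0, hv, hE, hZ⟩ := h
  obtain ⟨-, -, v', hv0', hv', hE', hZ'⟩ := h'
  exact highest_weight_unique hv0 hv hE hZ hv0' hv' hE' hZ'

theorem IsMaximalVector.hasHighestWeight {v : V} (h0 : 0 ≤ i) (h1 : i ≤ κd - κ1)
    (h : IsMaximalVector V κd κ1 (qInt n) (domZeta κd κ1 n i) v) :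
    HasHighestWeight V κd κ1 n i := by
  obtain ⟨hd, he, hn, hZ⟩ := QSP.mem_weightSpace.mp h.mem_weightSpace
  exact ⟨h0, h1, v, h.ne_zero, ⟨hd, he, hn⟩, h.B1_smul, hZ⟩

theorem exists_hasHighestWeight (hV : IsRational V) [IsSimpleModule U V] :
    ∃ κd κ1 n i : ℤ, HasHighestWeight V κd κ1 n i := by
  have := IsSimpleModule.nontrivial U V
  obtain ⟨κd, κ1, n, i, v, h0, h1, h⟩ := exists_maximal_of_isRational hV
  exact ⟨κd, κ1, n, i, h0, h1, v, h⟩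

end

/-! ### Labels of isomorphism classes -/

theorem RatIrrep.exists_label (V : RatIrrep) :
    ∃ l, ∀ κd κ1 n i : ℤ, HasHighestWeight V.carrier κd κ1 n i → l = label κd κ1 n i := by
  have := V.irreducible
  obtain ⟨κd, κ1, n, i, h⟩ := exists_hasHighestWeight V.rational
  refine ⟨label κd κ1 n i, fun κd' κ1' n' i' h' => ?_⟩
  obtain ⟨rfl, rfl, rfl, rfl⟩ := h.unique h'
  rfl

/-- The pair attached to the highest weight of an irreducible rational representation. -/
def RatIrrep.label (V : RatIrrep) : (ℚ × ℚ) × (ℚ × ℚ) := V.exists_label.choose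

theorem RatIrrep.label_eq {V : RatIrrep} {κd κ1 n i : ℤ}
    (h : HasHighestWeight V.carrier κd κ1 n i) : V.label = QSP.label κd κ1 n i :=
  V.exists_label.choose_spec _ _ _ _ h

/-- Taking the pair attached to the highest weight, on isomorphism classes. -/
def RatIrrepClass.label : RatIrrepClass → (ℚ × ℚ) × (ℚ × ℚ) :=
  Quotient.lift RatIrrep.label fun V W ⟨e⟩ => by
    have := V.irreducible
    obtain ⟨κd, κ1, n, i, h⟩ := exists_hasHighestWeight V.rational
    rw [RatIrrep.label_eq h, RatIrrep.label_eq (h.of_equiv e)]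

theorem label_injective {κd κ1 n i κd' κ1' n' i' : ℤ}
    (h : label κd κ1 n i = label κd' κ1' n' i') : κd = κd' ∧ κ1 = κ1' ∧ n = n' ∧ i = i' := by
  simp only [label, Prod.mk.injEq] at h
  obtain ⟨⟨h1, h2⟩, h3, h4⟩ := h
  have e1 : (κd : ℚ) = κd' := by linarith
  have e2 : (n : ℚ) = n' := by linarith
  have e3 : (i : ℚ) = i' := by linarith
  have e4 : (κ1 : ℚ) = κ1' := by linarith
  exact ⟨by exact_mod_cast e1, by exact_mod_cast e4, by exact_mod_cast e2, by exact_mod_cast e3⟩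

theorem label_mem_PHalfPairs {κd κ1 n i : ℤ} (h0 : 0 ≤ i) (h1 : i ≤ κd - κ1) :
    label κd κ1 n i ∈ PHalfPairs := by
  obtain ⟨j, rfl⟩ := Int.eq_ofNat_of_zero_le h0
  -- `k = κ - i` is the difference of the entries of the second pair, as `j = i` is for the first.
  obtain ⟨k, hk⟩ := Int.eq_ofNat_of_zero_le (sub_nonneg.mpr h1)
  have hk' : (κd : ℚ) - κ1 - j = k := by exact_mod_cast hk
  refine ⟨⟨⟨j, ?_⟩, ⟨κd + n, ?_⟩, ⟨κd + n - 2 * j, ?_⟩⟩,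
    ⟨⟨k, ?_⟩, ⟨κd - n, ?_⟩, ⟨κd - n - 2 * k, ?_⟩⟩, ⟨n, ?_⟩⟩ <;>
    simp only [label] <;> push_cast <;> linarith

theorem exists_label_eq {p : (ℚ × ℚ) × (ℚ × ℚ)} (hp : p ∈ PHalfPairs) :
    ∃ κd κ1 n i : ℤ, 0 ≤ i ∧ i ≤ κd - κ1 ∧ label κd κ1 n i = p := by
  obtain ⟨⟨l1, l2⟩, ⟨m1, m2⟩⟩ := p
  obtain ⟨⟨⟨j, hj⟩, ⟨a, ha⟩, -⟩, ⟨⟨k, hk⟩, -, -⟩, ⟨m, hm⟩⟩ := hp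
  simp only at hj ha hk hm
  -- Here `a = κd + n` is twice the first entry, `m = n` is the difference of the leading entries,
  -- and `j + k = κ`.
  refine ⟨a - m, a - m - j - k, m, j, by omega, by omega, ?_⟩
  simp only [label, Prod.mk.injEq]
  push_cast
  refine ⟨⟨?_, ?_⟩, ?_, ?_⟩ <;> linarith

end

end QSP

theorem theorem5p5 :
    -- classification, and decomposition into one-dimensional weight spaces
    (∀ (V : Type*) [AddCommGroup V] [Module QSP.Cq V] [Module QSP.U V]
        [IsScalarTower QSP.Cq QSP.U V],
      QSP.IsRational V → IsSimpleModule QSP.U V →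
        (∃ κd κ1 n i : ℤ, 0 ≤ i ∧ i ≤ κd - κ1 ∧
          Nonempty (V ≃ₗ[QSP.U] QSP.L κd κ1 (QSP.qInt n) (QSP.domZeta κd κ1 n i))) ∧
        QSP.IsSumOfWeightLines V) ∧
    -- all the modules in the list occur
    (∀ κd κ1 n i : ℤ, 0 ≤ i → i ≤ κd - κ1 →
      QSP.IsRational (QSP.L κd κ1 (QSP.qInt n) (QSP.domZeta κd κ1 n i)) ∧
      IsSimpleModule QSP.U (QSP.L κd κ1 (QSP.qInt n) (QSP.domZeta κd κ1 n i))) ∧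
    -- taking the highest weight is a bijection from isomorphism classes to pairs
    (∃ hw : QSP.RatIrrepClass → (ℚ × ℚ) × (ℚ × ℚ),
      (∀ (V : QSP.RatIrrep) (κd κ1 n i : ℤ), 0 ≤ i → i ≤ κd - κ1 →
        Nonempty (V.carrier ≃ₗ[QSP.U]
          QSP.L κd κ1 (QSP.qInt n) (QSP.domZeta κd κ1 n i)) →
        hw ⟦V⟧ = QSP.label κd κ1 n i) ∧
      (∀ (V : QSP.RatIrrep) (κd κ1 n i : ℤ) (v : V.carrier), 0 ≤ i → i ≤ κd - κ1 →
        QSP.IsMaximalVector V.carrier κd κ1 (QSP.qInt n) (QSP.domZeta κd κ1 n i) v →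
        hw ⟦V⟧ = QSP.label κd κ1 n i) ∧
      Function.Injective hw ∧ Set.range hw = QSP.PHalfPairs) := by
  refine ⟨fun V _ _ _ _ hV hs => ⟨QSP.exists_equiv_L hV, QSP.isSumOfWeightLines_of_isRational hV⟩,
    fun κd κ1 n i h0 h1 => ⟨QSP.isRational_L_domZeta h0 h1, QSP.isSimpleModule_L_domZeta h0 h1⟩,
    QSP.RatIrrepClass.label, ?_, ?_, ?_, ?_⟩
  · rintro V κd κ1 n i h0 h1 ⟨e⟩
    exact QSP.RatIrrep.label_eq ((QSP.hasHighestWeight_L h0 h1).of_equiv e.symm)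
  · intro V κd κ1 n i v h0 h1 hv
    exact QSP.RatIrrep.label_eq (hv.hasHighestWeight h0 h1)
  · rintro ⟨V⟩ ⟨W⟩ h
    have := V.irreducible
    have := W.irreducible
    obtain ⟨κd, κ1, n, i, hV⟩ := QSP.exists_hasHighestWeight V.rational
    obtain ⟨κd', κ1', n', i', hW⟩ := QSP.exists_hasHighestWeight W.rational
    have hl : QSP.label κd κ1 n i = QSP.label κd' κ1' n' i' :=
      (QSP.RatIrrep.label_eq hV).symm.trans (Eq.trans h (QSP.RatIrrep.label_eq hW))
    obtain ⟨rfl, rfl, rfl, rfl⟩ := QSP.label_injective hl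
    obtain ⟨e⟩ := hV.equiv_L
    obtain ⟨f⟩ := hW.equiv_L
    exact Quotient.sound ⟨e.trans f.symm⟩
  · ext p
    constructor
    · rintro ⟨⟨V⟩, rfl⟩
      have := V.irreducible
      obtain ⟨κd, κ1, n, i, hV⟩ := QSP.exists_hasHighestWeight V.rational
      have hl : QSP.RatIrrepClass.label (Quot.mk _ V) = QSP.label κd κ1 n i :=
        QSP.RatIrrep.label_eq hV
      rw [hl]
      exact QSP.label_mem_PHalfPairs hV.1 hV.2.1
    · intro hp
      obtain ⟨κd, κ1, n, i, h0, h1, rfl⟩ := QSP.exists_label_eq hp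
      let V : QSP.RatIrrep :=
        { carrier := QSP.L κd κ1 (QSP.qInt n) (QSP.domZeta κd κ1 n i)
          rational := QSP.isRational_L_domZeta h0 h1
          irreducible := QSP.isSimpleModule_L_domZeta h0 h1 }
      exact ⟨⟦V⟧, QSP.RatIrrep.label_eq (V := V) (QSP.hasHighestWeight_L h0 h1)⟩
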